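/- Let $r\ge 1$ and $\gamma_1,\dots,\gamma_r\in\mathbb C$ with $\Re\gamma_j>0$ for all $j$. For $t=(t_1,\dots,t_r)\in\mathbb C^r$ put $T_j=\sum_{k=j}^r t_k$. For $\varepsilon>0$ let $\mathcal C=\mathcal C_\varepsilon$ be the Hankel contour, which runs from $+\infty$ to $\varepsilon$ along the real axis ($\arg t=0$), then once counterclockwise around the circle $|t|=\varepsilon$, then from $\varepsilon$ to $+\infty$ along the real axis ($\arg t=2\pi$). For $s\in\mathbb C^r$ with no integer coordinate, the desingularized multiple zeta-function is defined by $$\zeta^{\rm des}_r((s_j);(\gamma_j))=\lim_{\substack{c\to1\\ c\in\mathbb R\setminus\{1\}}}\frac{(-1)^r}{(c-1)^r}\prod_{k=1}^r\frac{1}{(e^{2\pi i s_k}-1)\Gamma(s_k)}\int_{\mathcal C^r}\prod_{j=1}^r\left(\frac{1}{e^{\gamma_jT_j}-1}-\frac{c}{e^{c\gamma_jT_j}-1}\right)\prod_{k=1}^r t_k^{s_k-1}\,dt_k ,$$ with $\varepsilon$ sufficiently small, and it is extended to the remaining points of $\mathbb C^r$ by continuity. Removable singularities of the integrand and of the functions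 below are filled in by continuity. Then the integral and the limits that define $\zeta^{\rm des}_r$ at points without integer coordinates and at the points $(-m_j)$ with $m_j\in\mathbb Z_{\ge0}$ exist for all sufficiently small $\varepsilon$ (for $c\ne 1$ close to $1$ in the case of the integral), the values at the points $(-m_j)$ do not depend on $\varepsilon$, and, for all $t$ in a neighbourhood of $0\in\mathbb C^r$, $$\prod_{j=1}^r\frac{(1-\gamma_jT_j)e^{\gamma_jT_j}-1}{(e^{\gamma_jT_j}-1)^2}=\sum_{m_1,\dots,m_r=0}^\infty(-1)^{m_1+\cdots+m_r}\,\zeta^{\rm des}_r((-m_j);(\gamma_j))\prod_{j=1}^r\frac{t_j^{m_j}}{m_j!},$$ the series being absolutely convergent. Moreover, for all $k_1,\dots,k_r\in\mathbb Z_{\ge0}$, $$\zeta^{\rm des}_r((-k_j);(\gamma_j))=\prod_{l=1}^r(-1)^{k_l}k_l!\;\sum_{\nu}\;\prod_{j=1}^r\left(B_{1+\sum_{l=j}^r\nu_{jl}}\;\gamma_j^{\sum_{l=j}^r\nu_{jl}}\;\frac{1}{\prod_{d=1}^j\nu_{dj}!}\right),$$ where $\nu=(\nu_{dj})_{1\le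 d\le j\le r}$ runs over the families of non-negative integers with $\sum_{d=1}^j\nu_{dj}=k_j$ for $1\le j\le r$, and $B_n$ are the Bernoulli numbers, $\frac{x}{e^x-1}=\sum_{n\ge0}B_n\frac{x^n}{n!}$. -/

import Mathlib

open Filter Topology MeasureTheory

noncomputable section

namespace DesZeta

/-- The tail sum `T_j = ∑_{k ≥ j} t_k`. -/
def tailSum {r : ℕ} (t : Fin r → ℂ) (j : Fin r) : ℂ :=
  ∑ k ∈ Finset.Ici j, t k

/-- `1/(e^y - 1) - c/(e^{cy} - 1)`; at the removable singularity `y = 0` it is given its limit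
value `(c - 1)/2`. -/
def kernel (c : ℝ) (y : ℂ) : ℂ :=
  if y = 0 then ((c : ℂ) - 1) / 2
  else 1 / (Complex.exp y - 1) - (c : ℂ) / (Complex.exp ((c : ℂ) * y) - 1)

/-- `∏_j (1/(exp(γ_j T_j) - 1) - c/(exp(c γ_j T_j) - 1))`. -/
def tildeH {r : ℕ} (γ : Fin r → ℂ) (c : ℝ) (t : Fin r → ℂ) : ℂ :=
  ∏ j, kernel c (γ j * tailSum t j)

/-- The Hankel contour of radius `ε`, parametrized by the real line: from `+∞` to `ε` along the
real axis (`u < 0`), once counterclockwise around the circle of radius `ε` (`0 ≤ u ≤ 2π`), and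
back from `ε` to `+∞` along the real axis (`2π < u`). -/
def hankelPath (ε u : ℝ) : ℂ :=
  if u < 0 then ((ε - u : ℝ) : ℂ)
  else if u ≤ 2 * Real.pi then (ε : ℂ) * Complex.exp (Complex.I * u)
  else ((ε + (u - 2 * Real.pi) : ℝ) : ℂ)

/-- The velocity of `hankelPath ε` (the two corners, where any value will do, are put on the
circle). -/
def hankelVel (ε u : ℝ) : ℂ :=
  if u < 0 then -1
  else if u ≤ 2 * Real.pi then Complex.I * ((ε : ℂ) * Complex.exp (Complex.I * u))
  else 1

/-- The continuous branch of `log t` along the Hankel contour: the argument is `0` on the incoming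
ray, runs from `0` to `2π` on the circle, and is `2π` on the outgoing ray. -/
def hankelLog (ε u : ℝ) : ℂ :=
  if u < 0 then (Real.log (ε - u) : ℂ)
  else if u ≤ 2 * Real.pi then (Real.log ε : ℂ) + Complex.I * u
  else (Real.log (ε + (u - 2 * Real.pi)) : ℂ) + Complex.I * (2 * Real.pi)

/-- The pulled back integrand `tildeH (t) ∏_k t_k^{s_k - 1} dt_k` on the `r`-fold Hankel
contour. -/
def integrand {r : ℕ} (ε : ℝ) (γ : Fin r → ℂ) (c : ℝ) (s : Fin r → ℂ) (u : Fin r → ℝ) : ℂ :=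
  tildeH γ c (fun k => hankelPath ε (u k)) *
    ∏ k, (Complex.exp ((s k - 1) * hankelLog ε (u k)) * hankelVel ε (u k))

/-- The quantity whose limit as `c → 1` defines the desingularized multiple zeta-function. -/
def approx {r : ℕ} (ε : ℝ) (γ : Fin r → ℂ) (c : ℝ) (s : Fin r → ℂ) : ℂ :=
  (-1) ^ r / ((c : ℂ) - 1) ^ r *
    (∏ k, 1 / ((Complex.exp (2 * Real.pi * Complex.I * s k) - 1) * Complex.Gamma (s k))) *
    ∫ u : Fin r → ℝ, integrand ε γ c s u

/-- The points of `ℂ^r` none of whose coordinates is an integer: there no factor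
`(e^{2πi s_k} - 1) Γ(s_k)` vanishes or has a pole. -/
def nonIntegral (r : ℕ) : Set (Fin r → ℂ) :=
  {s | ∀ k, ∀ n : ℤ, s k ≠ (n : ℂ)}

/-- The limit as `c → 1`, `c ≠ 1`. Used at points of `nonIntegral r`. -/
def generic {r : ℕ} (ε : ℝ) (γ : Fin r → ℂ) (s : Fin r → ℂ) : ℂ :=
  limUnder (𝓝[≠] (1 : ℝ)) (fun c => approx ε γ c s)

/-- The desingularized multiple zeta-function `ζ_r^des((s_j);(γ_j))` on all of `ℂ^r`: the defining
limit at points without integer coordinates, continued to the remaining points by continuity.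
The limit in `ε` implements the choice of a sufficiently small radius of the contour. -/
def desZeta {r : ℕ} (γ : Fin r → ℂ) (s : Fin r → ℂ) : ℂ :=
  limUnder (𝓝[>] (0 : ℝ)) (fun ε => limUnder (𝓝[nonIntegral r] s) (generic ε γ))

/-- `((1 - y) e^y - 1)/(e^y - 1)^2`; at the removable singularity `y = 0` it is given its limit
value `-1/2`. -/
def genFactor (y : ℂ) : ℂ :=
  if y = 0 then -1 / 2
  else ((1 - y) * Complex.exp y - 1) / (Complex.exp y - 1) ^ 2

/-- The families `(ν_{dj})_{1 ≤ d ≤ j ≤ r}` of natural numbers with `∑_{d ≤ j} ν_{dj} = k_j` for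
every `j`. The entry `ν_{dj}` is `ν j d`; entries with `d > j` are `0`. -/
def indexFamilies {r : ℕ} (k : Fin r → ℕ) : Finset (Fin r → Fin r → ℕ) :=
  Fintype.piFinset (fun j => Finset.piAntidiag (Finset.Iic j) (k j))

end DesZeta

end

/-! Write b(z) = z/(e^z - 1) = ∑ B_n z^n/n!. Two identities drive everything. Off y = 0 the kernel
is (b(y) - b(cy))/y (`kernel_eq`), and `genFactor` is b' (`hasDerivAt_bernoulliGen`). So the kernel
divided by c - 1 tends to -b'(y), and the signs cancel the (-1)^r in front. For small ε the
arguments γ_j T_j stay away from the poles 2πin, n ≠ 0, because T_j lies close to the positive real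
axis and Re γ_j > 0. There b' decays exponentially, and the mean value inequality in c passes this
on to the kernels. Dominated convergence (`tendsto_approx`) gives the limit as `hankelFactor s`
times the Hankel integral of ∏ b'(γ_j T_j) t_j^{s_j-1}, which is continuous in s. At s = (-m_j) the
reflection formula makes the prefactor tend to ∏ (-1)^{m_j} m_j!/(2πi) (`tendsto_hankelFactor`). The
powers become single-valued, so the two rays cancel, and Cauchy's formula on the torus leaves a
Taylor coefficient of ∏ b'(γ_j T_j). This is the generating function. Expanding b'(z) = ∑ B_{n+1}
z^n/n! and each power of T_j by the multinomial theorem gives the explicit values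
(`hasSum_taylorCoeff`). -/

namespace DesZeta

/-! ### The Bernoulli generating function and its derivative. -/

/-- The generating function `z/(e^z - 1)` of the Bernoulli numbers, with value `1` at `z = 0`. -/
noncomputable def bernoulliGen (z : ℂ) : ℂ :=
  if z = 0 then 1 else z / (Complex.exp z - 1)

/-- The coefficients `B_n/n!`. -/
noncomputable def bernoulliCoeff (n : ℕ) : ℂ := ((bernoulli n : ℚ) : ℂ) / (n.factorial : ℂ)

/-- The Bernoulli recurrence divided by (n+1)!: coefficient by coefficient it says that (∑ B_k
z^k/k!) · (e^z - 1)/z = 1. -/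
lemma sum_bernoulliCoeff_div_factorial (n : ℕ) :
    ∑ k ∈ Finset.range (n + 1), bernoulliCoeff k * (1 / ((n - k + 1).factorial : ℂ)) =
      if n = 0 then 1 else 0 := by
  have h := congrArg (fun q : ℚ => (q : ℂ) / ((n + 1).factorial : ℂ)) (sum_bernoulli (n + 1))
  simp only [Rat.cast_sum, Rat.cast_mul, Finset.sum_div] at h
  have h2 : ∀ k ∈ Finset.range (n + 1),
      bernoulliCoeff k * (1 / ((n - k + 1).factorial : ℂ)) =
      (((n + 1).choose k : ℚ) : ℂ) * ((bernoulli k : ℚ) : ℂ) / ((n + 1).factorial : ℂ) := by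
    intro k hk
    have hk' : k ≤ n := Nat.lt_succ_iff.mp (Finset.mem_range.mp hk)
    have h3 := Nat.choose_mul_factorial_mul_factorial (n := n + 1) (k := k) (by omega)
    rw [show n + 1 - k = n - k + 1 by omega] at h3
    have h4 : (((n + 1).choose k : ℕ) : ℂ) * (k.factorial : ℂ) * ((n - k + 1).factorial : ℂ) =
        ((n + 1).factorial : ℂ) := by exact_mod_cast h3
    have a1 : (k.factorial : ℂ) ≠ 0 := by exact_mod_cast k.factorial_ne_zero
    have a2 : ((n - k + 1).factorial : ℂ) ≠ 0 := by exact_mod_cast (n - k + 1).factorial_ne_zero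
    have a3 : ((n + 1).factorial : ℂ) ≠ 0 := by exact_mod_cast (n + 1).factorial_ne_zero
    rw [bernoulliCoeff, eq_div_iff a3, ← h4]
    push_cast
    field_simp
  rw [Finset.sum_congr rfl h2, h]
  rcases Nat.eq_zero_or_pos n with rfl | hn
  · simp
  · rw [if_neg (by omega), if_neg (by omega)]; simp

lemma sum_range_half_pow_sub_le (n : ℕ) :
    ∑ k ∈ Finset.range n, ((1 : ℝ) / 2) ^ (n - k) ≤ 1 := by
  induction n with
  | zero => simp
  | succ n ih =>
    rw [Finset.sum_range_succ]
    have : ∀ k ∈ Finset.range n, ((1 : ℝ) / 2) ^ (n + 1 - k) = (1 / 2) * (1 / 2) ^ (n - k) := by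
      intro k hk
      rw [Nat.succ_sub (Finset.mem_range.mp hk).le, pow_succ']
    rw [Finset.sum_congr rfl this, ← Finset.mul_sum]
    simp
    simp at ih
    linarith

/-- The recurrence expresses the n-th coefficient through earlier ones with weights 1/(n-k+1)! ≤
2^{-(n-k)}, whose sum is at most 1. This crude bound gives convergence on the unit disc, which is
all that is needed since ε may shrink. -/
lemma norm_bernoulliCoeff_le_one (n : ℕ) : ‖bernoulliCoeff n‖ ≤ 1 := by
  induction n using Nat.strong_induction_on with
  | _ n ih =>
    rcases Nat.eq_zero_or_pos n with rfl | hn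
    · simp [bernoulliCoeff]
    have h := sum_bernoulliCoeff_div_factorial n
    rw [Finset.sum_range_succ, if_neg hn.ne'] at h
    simp only [Nat.sub_self, zero_add, Nat.factorial_one, Nat.cast_one, div_one, mul_one] at h
    rw [eq_neg_of_add_eq_zero_right h, norm_neg]
    refine (norm_sum_le _ _).trans (le_trans (Finset.sum_le_sum fun k hk => ?_)
      (sum_range_half_pow_sub_le n))
    rw [norm_mul]
    have h1 := ih k (Finset.mem_range.mp hk)
    have h2 : ‖(1 / ((n - k + 1).factorial : ℂ))‖ ≤ (1 / 2) ^ (n - k) := by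
      have h3 : ((2 : ℝ) ^ (n - k)) ≤ ((n - k + 1).factorial : ℝ) := by
        have := Nat.factorial_mul_pow_le_factorial (m := 1) (n := n - k)
        rw [add_comm (n - k)]
        exact_mod_cast (by simpa using this)
      rw [norm_div, norm_one, Complex.norm_natCast, one_div_pow]
      exact one_div_le_one_div_of_le (by positivity) h3
    calc _ ≤ 1 * (1 / 2 : ℝ) ^ (n - k) := mul_le_mul h1 h2 (norm_nonneg _) zero_le_one
      _ = _ := one_mul _

lemma summable_norm_bernoulliCoeff {z : ℂ} (hz : ‖z‖ < 1) :
    Summable fun n => ‖bernoulliCoeff n * z ^ n‖ := by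
  refine Summable.of_nonneg_of_le (fun _ => norm_nonneg _) (fun n => ?_)
    (summable_geometric_of_lt_one (norm_nonneg z) hz)
  rw [norm_mul, norm_pow]
  exact mul_le_of_le_one_left (by positivity) (norm_bernoulliCoeff_le_one n)

/-- Stated without division, so that it also shows that e^z ≠ 1 on the punctured unit disc. -/
lemma tsum_bernoulliCoeff_mul {z : ℂ} (hz : ‖z‖ < 1) :
    (∑' n, bernoulliCoeff n * z ^ n) * (Complex.exp z - 1) = z := by
  have hexp : HasSum (fun n : ℕ => z ^ (n + 1) / ((n + 1).factorial : ℂ)) (Complex.exp z - 1) := by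
    have h : HasSum (fun n : ℕ => z ^ n / (n.factorial : ℂ)) (Complex.exp z) := by
      rw [Complex.exp_eq_exp_ℂ]
      exact NormedSpace.expSeries_div_hasSum_exp z
    rw [hasSum_nat_add_iff' (f := fun n : ℕ => z ^ n / (n.factorial : ℂ)) 1 |>.symm] at h
    simpa using h
  have hnorm : Summable fun n : ℕ => ‖1 / ((n + 1).factorial : ℂ) * z ^ n‖ := by
    refine Summable.of_nonneg_of_le (fun _ => norm_nonneg _) (fun n => ?_)
      (summable_geometric_of_lt_one (norm_nonneg z) hz)
    rw [norm_mul, norm_pow, norm_div, norm_one, Complex.norm_natCast]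
    refine mul_le_of_le_one_left (by positivity) ?_
    rw [div_le_one (by positivity)]
    exact_mod_cast Nat.succ_le_of_lt (Nat.factorial_pos _)
  have hE : Complex.exp z - 1 = z * ∑' n : ℕ, 1 / ((n + 1).factorial : ℂ) * z ^ n := by
    rw [← tsum_mul_left, ← hexp.tsum_eq]
    refine tsum_congr fun n => ?_
    rw [pow_succ]; ring
  rw [hE, mul_left_comm, tsum_mul_tsum_eq_tsum_sum_range_of_summable_norm
    (summable_norm_bernoulliCoeff hz) hnorm]
  have : ∀ n : ℕ, ∑ k ∈ Finset.range (n + 1), bernoulliCoeff k * z ^ k *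
      (1 / ((n - k + 1).factorial : ℂ) * z ^ (n - k)) = if n = 0 then 1 else 0 := by
    intro n
    have h1 : ∀ k ∈ Finset.range (n + 1), bernoulliCoeff k * z ^ k *
      (1 / ((n - k + 1).factorial : ℂ) * z ^ (n - k)) =
        bernoulliCoeff k * (1 / ((n - k + 1).factorial : ℂ)) * z ^ n := by
      intro k hk
      have hk' : k ≤ n := Nat.lt_succ_iff.mp (Finset.mem_range.mp hk)
      rw [← pow_mul_pow_sub z hk']; ring
    rw [Finset.sum_congr rfl h1, ← Finset.sum_mul, sum_bernoulliCoeff_div_factorial]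
    split_ifs with h <;> simp [h]
  simp_rw [this]
  simp

lemma exp_ne_one_of_norm_lt_one {z : ℂ} (hz : ‖z‖ < 1) (h0 : z ≠ 0) : Complex.exp z ≠ 1 := by
  intro h
  have := tsum_bernoulliCoeff_mul hz
  rw [h, sub_self, mul_zero] at this
  exact h0 this.symm

lemma hasSum_bernoulliGen {z : ℂ} (hz : ‖z‖ < 1) :
    HasSum (fun n => bernoulliCoeff n * z ^ n) (bernoulliGen z) := by
  have hs := (summable_norm_bernoulliCoeff hz).of_norm.hasSum
  suffices h : bernoulliGen z = ∑' n, bernoulliCoeff n * z ^ n from h ▸ hs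
  unfold bernoulliGen
  split_ifs with h0
  · subst h0
    rw [tsum_eq_single 0 (by intro n hn; simp [hn])]
    simp [bernoulliCoeff]
  · rw [div_eq_iff (sub_ne_zero.mpr (exp_ne_one_of_norm_lt_one hz h0)),
      tsum_bernoulliCoeff_mul hz]

lemma hasSum_deriv_bernoulliGen {z : ℂ} (hz : ‖z‖ < 1) :
    HasSum (fun n : ℕ => ((bernoulli (n + 1) : ℚ) : ℂ) / (n.factorial : ℂ) * z ^ n)
      (deriv bernoulliGen z) ∧ DifferentiableAt ℂ bernoulliGen z := by
  obtain ⟨ρ, hρ, hρ1⟩ := exists_between hz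
  have hρ0 : 0 < ρ := (norm_nonneg z).trans_lt hρ
  have hzb : z ∈ Metric.ball (0 : ℂ) ρ := by simpa using hρ
  have hu := summable_geometric_of_lt_one hρ0.le hρ1
  have hF : ∀ n : ℕ, DifferentiableOn ℂ (fun w : ℂ => bernoulliCoeff n * w ^ n)
      (Metric.ball 0 ρ) := fun n => by fun_prop
  have hb : ∀ (n : ℕ) (w : ℂ), w ∈ Metric.ball (0 : ℂ) ρ → ‖bernoulliCoeff n * w ^ n‖ ≤ ρ ^ n := by
    intro n w hw
    rw [norm_mul, norm_pow]
    have hw' : ‖w‖ ≤ ρ := by simpa using (mem_ball_zero_iff.mp hw).le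
    calc _ ≤ 1 * ρ ^ n := by
          gcongr
          exact norm_bernoulliCoeff_le_one n
      _ = _ := one_mul _
  have heq : (fun w : ℂ => ∑' n, bernoulliCoeff n * w ^ n) =ᶠ[𝓝 z] bernoulliGen := by
    filter_upwards [Metric.isOpen_ball.mem_nhds hzb] with w hw
    exact (hasSum_bernoulliGen ((mem_ball_zero_iff.mp hw).trans hρ1)).tsum_eq
  have hd := Complex.hasSum_deriv_of_summable_norm hu hF Metric.isOpen_ball hb hzb
  have hdiff := (Complex.differentiableOn_tsum_of_summable_norm hu hF Metric.isOpen_ball hb).differentiableAt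
    (Metric.isOpen_ball.mem_nhds hzb)
  refine ⟨?_, hdiff.congr_of_eventuallyEq heq.symm⟩
  -- The constant term has derivative 0; dropping it shifts the index and produces B_{n+1}/n!.
  rw [heq.deriv_eq, ← hasSum_nat_add_iff' 1] at hd
  simp only [Finset.range_one, Finset.sum_singleton, pow_zero, mul_one, deriv_const, sub_zero]
    at hd
  refine hd.congr_fun fun n => ?_
  rw [deriv_const_mul _ (by fun_prop)]
  simp only [deriv_pow_field, bernoulliCoeff, Nat.add_sub_cancel, Nat.factorial_succ]
  push_cast
  have : (n.factorial : ℂ) ≠ 0 := by exact_mod_cast n.factorial_ne_zero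
  have : (n : ℂ) + 1 ≠ 0 := by exact_mod_cast n.succ_ne_zero
  field_simp

/-- The complement of the poles of `z/(e^z - 1)`. -/
def regularSet : Set ℂ := {z | z = 0 ∨ Complex.exp z ≠ 1}

lemma ball_subset_regularSet : Metric.ball (0 : ℂ) 1 ⊆ regularSet := by
  intro z hz
  by_cases h0 : z = 0
  · exact Or.inl h0
  · exact Or.inr (exp_ne_one_of_norm_lt_one (mem_ball_zero_iff.mp hz) h0)

lemma isOpen_regularSet : IsOpen regularSet := by
  have : regularSet = Metric.ball (0 : ℂ) 1 ∪ {z | Complex.exp z ≠ 1} := by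
    ext z
    constructor
    · rintro (h | h)
      · left; simp [h]
      · exact Or.inr h
    · rintro (h | h)
      · exact ball_subset_regularSet h
      · exact Or.inr h
  rw [this]
  exact Metric.isOpen_ball.union (isOpen_ne_fun Complex.continuous_exp continuous_const)

/-- Away from 0 this is the quotient rule. At 0 the derivative is read off the power series: it is
B_1 = -1/2, the value filled in for `genFactor`. -/
lemma hasDerivAt_bernoulliGen {z : ℂ} (hz : z ∈ regularSet) :
    HasDerivAt bernoulliGen (genFactor z) z := by
  by_cases h0 : z = 0
  · subst h0
    have h := hasSum_deriv_bernoulliGen (z := 0) (by simp)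
    suffices h' : genFactor 0 = deriv bernoulliGen 0 from h' ▸ h.2.hasDerivAt
    rw [← h.1.tsum_eq, tsum_eq_single 0 (by intro n hn; simp [hn])]
    simp [genFactor]
  · have he : Complex.exp z - 1 ≠ 0 := sub_ne_zero.mpr (hz.resolve_left h0)
    have h1 : HasDerivAt (fun w : ℂ => w / (Complex.exp w - 1))
        ((1 * (Complex.exp z - 1) - z * Complex.exp z) / (Complex.exp z - 1) ^ 2) z :=
      (hasDerivAt_id z).div ((Complex.hasDerivAt_exp z).sub_const 1) he
    have h2 : bernoulliGen =ᶠ[𝓝 z] fun w : ℂ => w / (Complex.exp w - 1) := by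
      filter_upwards [isOpen_ne.mem_nhds h0] with w hw
      rw [bernoulliGen, if_neg hw]
    refine (h1.congr_of_eventuallyEq h2).congr_deriv ?_
    rw [genFactor, if_neg h0]
    ring

/-- Being the derivative of a holomorphic function, `genFactor` needs no separate study at its
removable singularity. -/
lemma continuousOn_genFactor : ContinuousOn genFactor regularSet := by
  have h : DifferentiableOn ℂ bernoulliGen regularSet := fun z hz =>
    (hasDerivAt_bernoulliGen hz).differentiableAt.differentiableWithinAt
  exact (h.deriv isOpen_regularSet).continuousOn.congr fun z hz =>
    (hasDerivAt_bernoulliGen hz).deriv.symm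

lemma hasSum_genFactor {z : ℂ} (hz : ‖z‖ < 1) :
    HasSum (fun n : ℕ => ((bernoulli (n + 1) : ℚ) : ℂ) / (n.factorial : ℂ) * z ^ n)
      (genFactor z) := by
  have h := (hasSum_deriv_bernoulliGen hz).1
  rwa [(hasDerivAt_bernoulliGen (ball_subset_regularSet (mem_ball_zero_iff.mpr hz))).deriv] at h

lemma norm_bernoulli_succ_div_factorial_le (n : ℕ) :
    ‖((bernoulli (n + 1) : ℚ) : ℂ) / (n.factorial : ℂ)‖ ≤ (n : ℝ) + 1 := by
  have h := norm_bernoulliCoeff_le_one (n + 1)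
  have : ((bernoulli (n + 1) : ℚ) : ℂ) / (n.factorial : ℂ) =
      bernoulliCoeff (n + 1) * ((n : ℂ) + 1) := by
    have : (n.factorial : ℂ) ≠ 0 := by exact_mod_cast n.factorial_ne_zero
    have : (n : ℂ) + 1 ≠ 0 := by exact_mod_cast n.succ_ne_zero
    rw [bernoulliCoeff, Nat.factorial_succ]
    push_cast
    field_simp
  rw [this, norm_mul]
  have h2 : ‖(n : ℂ) + 1‖ = (n : ℝ) + 1 := by
    have := Complex.norm_natCast (n + 1)
    push_cast at this
    exact this
  rw [h2]
  exact mul_le_of_le_one_left (by positivity) h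

lemma summable_norm_bernoulli_succ {x : ℝ} (hx0 : 0 ≤ x) (hx : x < 1) :
    Summable fun n : ℕ => ‖((bernoulli (n + 1) : ℚ) : ℂ) / (n.factorial : ℂ)‖ * x ^ n := by
  have h1 : Summable fun n : ℕ => ((n : ℝ) + 1) * x ^ n := by
    have h2 := summable_pow_mul_geometric_of_norm_lt_one 1
      (r := x) (by rwa [Real.norm_of_nonneg hx0])
    refine (h2.add (summable_geometric_of_lt_one hx0 hx)).congr fun n => ?_
    simp; ring
  refine Summable.of_nonneg_of_le (fun n => by positivity) (fun n => ?_) h1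
  gcongr
  exact norm_bernoulli_succ_div_factorial_le n

/-! ### Taylor expansion of the product, by regrouping multiple series. -/

section Fibers

variable {β κ : Type*}

lemma summable_of_summable_sum_fibers {φ : β → ℝ} (h0 : ∀ b, 0 ≤ φ b) (g : β → κ)
    (S : κ → Finset β) (hS : ∀ b, b ∉ S (g b) → φ b = 0)
    (hs : Summable fun k => ∑ b ∈ S k, φ b) : Summable φ := by
  classical
  refine summable_of_sum_le (c := ∑' k, ∑ b ∈ S k, φ b) h0 fun u => ?_
  rw [← Finset.sum_fiberwise_of_maps_to (g := g) (t := u.image g)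
    (fun b hb => Finset.mem_image_of_mem g hb)]
  refine le_trans (Finset.sum_le_sum fun k _ => ?_)
    (hs.sum_le_tsum (u.image g) fun k _ => Finset.sum_nonneg fun b _ => h0 b)
  rw [← Finset.sum_filter_ne_zero]
  refine Finset.sum_le_sum_of_subset_of_nonneg (fun b hb => ?_) fun b _ _ => h0 b
  simp only [Finset.mem_filter] at hb
  by_contra hbS
  exact hb.2 (hS b (hb.1.2 ▸ hbS))

/-- The fibres of `g` may be infinite; the finite sets `S k` replace them because φ vanishes on the
rest of each fibre. -/
lemma hasSum_sum_fibers {E : Type*} [NormedAddCommGroup E] [CompleteSpace E] {φ : β → E} {a : E}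
    (h : HasSum φ a) (g : β → κ) (S : κ → Finset β) (hS : ∀ b, b ∉ S (g b) → φ b = 0)
    (hS' : ∀ k, ∀ b ∈ S k, g b = k) : HasSum (fun k => ∑ b ∈ S k, φ b) a := by
  refine (h.tsum_fiberwise g).congr_fun fun k => ?_
  rw [tsum_subtype, tsum_eq_sum (s := S k)]
  · refine Finset.sum_congr rfl fun b hb => ?_
    rw [Set.indicator_of_mem]
    exact hS' k b hb
  · intro b hb
    by_cases hk : g b = k
    · rw [Set.indicator_of_mem (by exact hk)]
      exact hS b (hk ▸ hb)
    · rw [Set.indicator_of_notMem (by exact hk)]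

end Fibers

lemma hasSum_prod_pi {ι : Type*} {n : ℕ} (f : Fin n → ι → ℂ) (a : Fin n → ℂ)
    (hs : ∀ j, Summable fun i => ‖f j i‖) (h : ∀ j, HasSum (f j) (a j)) :
    (Summable fun A : Fin n → ι => ‖∏ j, f j (A j)‖) ∧
      HasSum (fun A : Fin n → ι => ∏ j, f j (A j)) (∏ j, a j) := by
  induction n with
  | zero => exact ⟨(hasSum_fintype _).summable, by simp⟩
  | succ n ih =>
    obtain ⟨ih1, ih2⟩ := ih (fun j : Fin n => f j.succ) (fun j => a j.succ) (fun j => hs _) (fun j => h _)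
    have hn := (hs 0).mul_norm ih1
    have hh : HasSum (fun p : ι × (Fin n → ι) => f 0 p.1 * ∏ j : Fin n, f j.succ (p.2 j))
        (a 0 * ∏ j : Fin n, a j.succ) := by
      rw [← (h 0).tsum_eq, ← ih2.tsum_eq, tsum_mul_tsum_of_summable_norm (hs 0) ih1]
      exact hn.of_norm.hasSum
    constructor
    · rw [← (Fin.consEquiv (fun _ : Fin (n + 1) => ι)).summable_iff]
      refine hn.congr fun p => ?_
      simp [Fin.consEquiv, Fin.prod_univ_succ]
    · rw [← (Fin.consEquiv (fun _ : Fin (n + 1) => ι)).hasSum_iff, Fin.prod_univ_succ]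
      refine hh.congr_fun fun p => ?_
      simp [Fin.consEquiv, Fin.prod_univ_succ]

/-- The multinomial theorem, over a general field because it serves both for complex values and for
their real norms. -/
lemma sum_piAntidiag_prod_pow_div_factorial {ι K : Type*} [Fintype ι] [DecidableEq ι] [Field K]
    [CharZero K] (s : Finset ι) (n : ℕ) (x : ι → K) :
    ∑ α ∈ s.piAntidiag n, (1 / ∏ l ∈ s, ((α l).factorial : K)) * ∏ l, x l ^ α l =
      (∑ l ∈ s, x l) ^ n / (n.factorial : K) := by
  rw [Finset.sum_pow_eq_sum_piAntidiag, Finset.sum_div]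
  refine Finset.sum_congr rfl fun α hα => ?_
  rw [Finset.mem_piAntidiag] at hα
  have h1 : ∏ l, x l ^ α l = ∏ l ∈ s, x l ^ α l := by
    refine (Finset.prod_subset (Finset.subset_univ s) fun l _ hl => ?_).symm
    have : α l = 0 := by
      by_contra h
      exact hl (hα.2 l h)
    rw [this, pow_zero]
  have h2 := Nat.multinomial_spec s α
  rw [hα.1] at h2
  have h3 : (∏ l ∈ s, ((α l).factorial : K)) * (Nat.multinomial s α : K) = (n.factorial : K) := by
    exact_mod_cast h2
  have h4 : (∏ l ∈ s, ((α l).factorial : K)) ≠ 0 :=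
    Finset.prod_ne_zero_iff.mpr fun l _ => by exact_mod_cast (α l).factorial_ne_zero
  have h5 : (n.factorial : K) ≠ 0 := by exact_mod_cast n.factorial_ne_zero
  rw [h1, eq_div_iff h5, ← h3]
  field_simp

/-- The coefficient of `∏ t_l ^ α_l` in the expansion of `genFactor (g * ∑ l ∈ s, t l)`. -/
noncomputable def factorCoeff {r : ℕ} (g : ℂ) (s : Finset (Fin r)) (α : Fin r → ℕ) : ℂ :=
  if ∀ l, α l ≠ 0 → l ∈ s then
    ((bernoulli (1 + ∑ l ∈ s, α l) : ℚ) : ℂ) * g ^ (∑ l ∈ s, α l) *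
      (1 / ∏ l ∈ s, ((α l).factorial : ℂ))
  else 0

/-- Multi-indices are grouped by total degree n. By the multinomial theorem the group sums to the
n-th term of the series of `genFactor`; the same with norms gives a convergent series at ‖g‖ ∑
‖t_l‖, hence absolute summability. -/
lemma hasSum_factorCoeff {r : ℕ} (g : ℂ) (s : Finset (Fin r)) (t : Fin r → ℂ)
    (h : ‖g‖ * ∑ l ∈ s, ‖t l‖ < 1) :
    (Summable fun α : Fin r → ℕ => ‖factorCoeff g s α * ∏ l, t l ^ α l‖) ∧
      HasSum (fun α : Fin r → ℕ => factorCoeff g s α * ∏ l, t l ^ α l)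
        (genFactor (g * ∑ l ∈ s, t l)) := by
  have hval : ∀ n, ∀ α ∈ s.piAntidiag n, factorCoeff g s α =
      ((bernoulli (n + 1) : ℚ) : ℂ) * g ^ n * (1 / ∏ l ∈ s, ((α l).factorial : ℂ)) := by
    intro n α hα
    rw [Finset.mem_piAntidiag] at hα
    rw [factorCoeff, if_pos hα.2, hα.1, add_comm 1 n]
  have hzero : ∀ α : Fin r → ℕ, α ∉ s.piAntidiag (∑ l ∈ s, α l) →
      factorCoeff g s α * ∏ l, t l ^ α l = 0 := by
    intro α hα
    rw [Finset.mem_piAntidiag] at hα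
    rw [factorCoeff, if_neg fun h' => hα ⟨rfl, h'⟩, zero_mul]
  have hnorm : ∀ n, ∑ α ∈ s.piAntidiag n, ‖factorCoeff g s α * ∏ l, t l ^ α l‖ =
      ‖((bernoulli (n + 1) : ℚ) : ℂ) / (n.factorial : ℂ)‖ * (‖g‖ * ∑ l ∈ s, ‖t l‖) ^ n := by
    intro n
    have h1 := sum_piAntidiag_prod_pow_div_factorial s n (fun l => ‖t l‖)
    rw [norm_div, Complex.norm_natCast, mul_pow, div_mul_eq_mul_div, mul_div_assoc, mul_div_assoc,
      ← h1, ← mul_assoc, Finset.mul_sum]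
    refine Finset.sum_congr rfl fun α hα => ?_
    rw [hval n α hα]
    simp only [norm_mul, norm_pow, norm_div, norm_one, norm_prod, Complex.norm_natCast]
    ring
  have hS : Summable fun α : Fin r → ℕ => ‖factorCoeff g s α * ∏ l, t l ^ α l‖ := by
    refine summable_of_summable_sum_fibers (fun _ => norm_nonneg _) (fun α => ∑ l ∈ s, α l)
      (fun n => s.piAntidiag n) (fun α hα => by rw [hzero α hα, norm_zero]) ?_
    refine (summable_norm_bernoulli_succ (by positivity) h).congr fun n => (hnorm n).symm
  refine ⟨hS, ?_⟩
  have hF := hasSum_sum_fibers hS.of_norm.hasSum (fun α => ∑ l ∈ s, α l)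
    (fun n => s.piAntidiag n) hzero (fun n α hα => (Finset.mem_piAntidiag.mp hα).1)
  have hlt : ‖g * ∑ l ∈ s, t l‖ < 1 := by
    refine lt_of_le_of_lt ?_ h
    rw [norm_mul]
    gcongr
    exact norm_sum_le _ _
  have hG := (hasSum_genFactor hlt).congr_fun
    (g := fun n => ∑ α ∈ s.piAntidiag n, factorCoeff g s α * ∏ l, t l ^ α l) fun n => by
      rw [mul_pow, div_mul_eq_mul_div, mul_div_assoc, mul_div_assoc,
        ← sum_piAntidiag_prod_pow_div_factorial s n t, ← mul_assoc, Finset.mul_sum]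
      refine Finset.sum_congr rfl fun α hα => ?_
      rw [hval n α hα]
      ring
  rw [← hF.unique hG]
  exact hS.of_norm.hasSum

/-- The Taylor coefficients at `0` of `∏ j, genFactor (γ j * T_j)`. -/
noncomputable def taylorCoeff {r : ℕ} (γ : Fin r → ℂ) (k : Fin r → ℕ) : ℂ :=
  ∑ ν ∈ indexFamilies k,
    ∏ j, (((bernoulli (1 + ∑ l ∈ Finset.Ici j, ν l j) : ℚ) : ℂ) *
      γ j ^ (∑ l ∈ Finset.Ici j, ν l j) *
      (1 / ∏ d ∈ Finset.Iic j, ((ν j d).factorial : ℂ)))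

lemma mem_indexFamilies {r : ℕ} {k : Fin r → ℕ} {ν : Fin r → Fin r → ℕ} :
    ν ∈ indexFamilies k ↔ ∀ j, ∑ d, ν j d = k j ∧ ∀ d, ν j d ≠ 0 → d ≤ j := by
  simp only [indexFamilies, Fintype.mem_piFinset, Finset.mem_piAntidiag, Finset.mem_Iic]
  refine forall_congr' fun j => and_congr_left fun h => ?_
  rw [Finset.sum_subset (Finset.subset_univ (Finset.Iic j))]
  intro d _ hd
  by_contra hne
  exact hd (Finset.mem_Iic.mpr (h d hne))

lemma sum_indexFamilies_prod_factorCoeff {r : ℕ} (γ t : Fin r → ℂ) (k : Fin r → ℕ) :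
    ∑ ν ∈ indexFamilies k, ∏ j, (factorCoeff (γ j) (Finset.Ici j) (fun l => ν l j) *
      ∏ l, t l ^ ν l j) = taylorCoeff γ k * ∏ l, t l ^ k l := by
  rw [taylorCoeff, Finset.sum_mul]
  refine Finset.sum_congr rfl fun ν hν => ?_
  rw [mem_indexFamilies] at hν
  have h1 : ∏ j, ∏ l, t l ^ ν l j = ∏ l, t l ^ k l := by
    rw [Finset.prod_comm]
    refine Finset.prod_congr rfl fun l _ => ?_
    rw [Finset.prod_pow_eq_pow_sum, (hν l).1]
  -- Both sides run over the pairs (smaller index, larger index), enumerated from either end.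
  have h2 : ∏ j, ∏ l ∈ Finset.Ici j, ((ν l j).factorial : ℂ) =
      ∏ j, ∏ d ∈ Finset.Iic j, ((ν j d).factorial : ℂ) :=
    Finset.prod_comm' (by simp)
  rw [Finset.prod_mul_distrib, h1]
  congr 1
  rw [Finset.prod_congr rfl fun j _ => show factorCoeff (γ j) (Finset.Ici j) (fun l => ν l j) = _ by
    rw [factorCoeff, if_pos fun l hl => Finset.mem_Ici.mpr ((hν l).2 j hl)]]
  simp only [Finset.prod_mul_distrib, Finset.prod_div_distrib, h2]

theorem hasSum_taylorCoeff {r : ℕ} (γ t : Fin r → ℂ) (h : ∀ j, ‖γ j‖ * ∑ l, ‖t l‖ < 1) :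
    (Summable fun m : Fin r → ℕ => ‖taylorCoeff γ m * ∏ l, t l ^ m l‖) ∧
      HasSum (fun m : Fin r → ℕ => taylorCoeff γ m * ∏ l, t l ^ m l)
        (∏ j, genFactor (γ j * tailSum t j)) := by
  have hj : ∀ j, ‖γ j‖ * ∑ l ∈ Finset.Ici j, ‖t l‖ < 1 := fun j => by
    refine lt_of_le_of_lt ?_ (h j)
    gcongr
    exact Finset.subset_univ _
  obtain ⟨hs, hsum⟩ := hasSum_prod_pi
    (fun (j : Fin r) (α : Fin r → ℕ) => factorCoeff (γ j) (Finset.Ici j) α * ∏ l, t l ^ α l)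
    (fun j => genFactor (γ j * tailSum t j))
    (fun j => (hasSum_factorCoeff (γ j) _ t (hj j)).1)
    (fun j => (hasSum_factorCoeff (γ j) _ t (hj j)).2)
  set φ : (Fin r → Fin r → ℕ) → ℂ := fun A =>
    ∏ j, (factorCoeff (γ j) (Finset.Ici j) (A j) * ∏ l, t l ^ A j l) with hφ
  -- In the product of series, `A j l` is the exponent of t_l taken from the j-th factor;
  -- `indexFamilies` lists the larger index first, hence the transposition.
  let e : (Fin r → Fin r → ℕ) ≃ (Fin r → Fin r → ℕ) := Equiv.piComm fun _ _ => ℕ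
  let S : (Fin r → ℕ) → Finset (Fin r → Fin r → ℕ) := fun k => (indexFamilies k).map e.toEmbedding
  have hmem : ∀ k A, A ∈ S k ↔ (fun l j => A j l) ∈ indexFamilies k := by
    intro k A
    rw [Finset.mem_map_equiv]
    rfl
  have hzero : ∀ A, A ∉ S (fun l => ∑ j, A j l) → φ A = 0 := by
    intro A hA
    rw [hmem, mem_indexFamilies] at hA
    push Not at hA
    obtain ⟨l, hl⟩ := hA
    obtain ⟨j, hne, hlt⟩ := hl rfl
    refine Finset.prod_eq_zero (Finset.mem_univ j) ?_
    rw [factorCoeff, if_neg, zero_mul]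
    intro h'
    exact absurd (Finset.mem_Ici.mp (h' l hne)) (not_le.mpr hlt)
  have hfib : ∀ k, ∀ A ∈ S k, (fun l => ∑ j, A j l) = k := by
    intro k A hA
    rw [hmem, mem_indexFamilies] at hA
    exact funext fun l => (hA l).1
  have hval : ∀ k, ∑ A ∈ S k, φ A = taylorCoeff γ k * ∏ l, t l ^ k l := by
    intro k
    rw [Finset.sum_map, ← sum_indexFamilies_prod_factorCoeff]
    rfl
  have h1 := hasSum_sum_fibers hsum _ S hzero hfib
  have h2 := hasSum_sum_fibers hs.hasSum _ S (fun A hA => by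
    rw [show ∏ j, _ = φ A from rfl, hzero A hA, norm_zero]) hfib
  constructor
  · refine Summable.of_nonneg_of_le (fun _ => norm_nonneg _) (fun k => ?_) h2.summable
    rw [← hval]
    exact norm_sum_le _ _
  · exact h1.congr_fun fun k => (hval k).symm

/-! ### Avoiding the poles, and uniform decay of `genFactor` and of the kernel. -/

/-- At a pole gT = 2πin with n ≠ 0; multiplying by the conjugate of g and taking imaginary parts
gives Im T · |g|² = 2πn Re g, too large for the hypothesis. -/
lemma mul_mem_regularSet {g T : ℂ} (h : |T.im| * Complex.normSq g < 2 * Real.pi * g.re) :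
    g * T ∈ regularSet := by
  by_cases h0 : g * T = 0
  · exact Or.inl h0
  refine Or.inr fun he => ?_
  obtain ⟨n, hn⟩ := Complex.exp_eq_one_iff.mp he
  have hn0 : n ≠ 0 := by
    rintro rfl
    exact h0 (by simpa using hn)
  have h1 : T.im * Complex.normSq g = n * (2 * Real.pi) * g.re := by
    have h2 := congrArg (fun z : ℂ => ((starRingEnd ℂ) g * z).im) hn
    simp only [← mul_assoc, ← Complex.normSq_eq_conj_mul_self] at h2
    simp [Complex.mul_im] at h2
    linarith
  have h3 : (1 : ℝ) ≤ |(n : ℝ)| := by exact_mod_cast Int.one_le_abs hn0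
  have hg : 0 ≤ |T.im| * Complex.normSq g := mul_nonneg (abs_nonneg _) (Complex.normSq_nonneg _)
  have h4 : |T.im| * Complex.normSq g = |(n : ℝ)| * (2 * Real.pi * |g.re|) := by
    rw [← abs_of_nonneg (Complex.normSq_nonneg g), ← abs_mul, h1, abs_mul, abs_mul,
      abs_of_pos Real.two_pi_pos]
    ring
  have h5 : 2 * Real.pi * g.re ≤ 2 * Real.pi * |g.re| :=
    mul_le_mul_of_nonneg_left (le_abs_self _) Real.two_pi_pos.le
  have h6 : 0 ≤ 2 * Real.pi * |g.re| := by positivity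
  nlinarith

lemma norm_genFactor_le_of_le_re {y : ℂ} (hy : 1 ≤ y.re) :
    ‖genFactor y‖ ≤ 4 * (2 + ‖y‖) * Real.exp (-y.re) := by
  have h0 : y ≠ 0 := by
    rintro rfl
    simp at hy
    linarith
  have hE : 2 ≤ Real.exp y.re := by
    have := Real.add_one_le_exp y.re
    linarith
  have h1 : Real.exp y.re / 2 ≤ ‖Complex.exp y - 1‖ := by
    have := norm_sub_norm_le (Complex.exp y) 1
    rw [Complex.norm_exp, norm_one] at this
    linarith
  have h2 : ‖(1 - y) * Complex.exp y - 1‖ ≤ (2 + ‖y‖) * Real.exp y.re := by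
    refine (norm_sub_le _ _).trans ?_
    rw [norm_mul, Complex.norm_exp, norm_one]
    have := norm_sub_le (1 : ℂ) y
    rw [norm_one] at this
    nlinarith
  rw [genFactor, if_neg h0, norm_div, norm_pow]
  have hpos : 0 < Real.exp y.re := Real.exp_pos _
  have hpos' : 0 < ‖Complex.exp y - 1‖ := lt_of_lt_of_le (by positivity) h1
  rw [div_le_iff₀ (by positivity)]
  have h3 : Real.exp (-y.re) * Real.exp y.re = 1 := by rw [← Real.exp_add]; simp
  calc _ ≤ (2 + ‖y‖) * Real.exp y.re := h2
    _ = 4 * (2 + ‖y‖) * Real.exp (-y.re) * (Real.exp y.re / 2) ^ 2 := by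
      linear_combination (-(2 + ‖y‖) * Real.exp y.re) * h3
    _ ≤ _ := by gcongr

/-- Compactness bounds the part with small x. For large x half of the decay rate Re g absorbs the
linear factor 2 + ‖y‖. -/
lemma exists_norm_genFactor_le {g : ℂ} (hg : 0 < g.re) {ρ : ℝ} (hρ0 : 0 ≤ ρ)
    (hρ : ρ * Complex.normSq g < 2 * Real.pi * g.re) :
    ∃ M δ : ℝ, 0 ≤ M ∧ 0 < δ ∧ ∀ (x : ℝ) (w : ℂ), 0 ≤ x → ‖w‖ ≤ ρ →
      g * (x + w) ∈ regularSet ∧ ‖genFactor (g * (x + w))‖ ≤ M * Real.exp (-δ * x) := by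
  have hreg : ∀ (x : ℝ) (w : ℂ), ‖w‖ ≤ ρ → g * (x + w) ∈ regularSet := by
    intro x w hw
    refine mul_mem_regularSet (lt_of_le_of_lt ?_ hρ)
    refine mul_le_mul_of_nonneg_right ?_ (Complex.normSq_nonneg _)
    simpa using (Complex.abs_im_le_norm w).trans hw
  -- Chosen so that x ≥ X forces Re(g(x + w)) ≥ 1.
  set X : ℝ := (‖g‖ * ρ + 1) / g.re with hX
  have hcomp : IsCompact (Set.Icc (0 : ℝ) X ×ˢ Metric.closedBall (0 : ℂ) ρ) :=
    isCompact_Icc.prod (isCompact_closedBall 0 ρ)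
  obtain ⟨C, hC⟩ := hcomp.exists_bound_of_continuousOn
    (f := fun p : ℝ × ℂ => genFactor (g * (p.1 + p.2)))
    (continuousOn_genFactor.comp (by fun_prop) fun p hp => hreg _ _ (by simpa using hp.2))
  set D : ℝ := 4 * (2 + ‖g‖ * ρ + ‖g‖ * (2 / g.re)) * Real.exp (‖g‖ * ρ) with hD
  have hD0 : 0 ≤ D := by positivity
  refine ⟨D + |C| * Real.exp (g.re / 2 * X), g.re / 2, by positivity, by positivity,
    fun x w hx hw => ⟨hreg x w hw, ?_⟩⟩
  rcases le_total x X with hxX | hxX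
  · calc _ ≤ |C| := (hC (x, w) ⟨⟨hx, hxX⟩, by simpa using hw⟩).trans (le_abs_self C)
      _ ≤ |C| * (Real.exp (g.re / 2 * X) * Real.exp (-(g.re / 2) * x)) := by
        rw [← Real.exp_add]
        refine le_mul_of_one_le_right (abs_nonneg C) (Real.one_le_exp ?_)
        nlinarith
      _ ≤ _ := by
        have : 0 ≤ D * Real.exp (-(g.re / 2) * x) := by positivity
        linarith
  · have hre : g.re * x - ‖g‖ * ρ ≤ (g * (x + w)).re := by
      have h1 : (g * (x + w)).re = g.re * x + (g * w).re := by
        rw [mul_add, Complex.add_re, Complex.re_mul_ofReal]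
      have h2 : -(g * w).re ≤ ‖g‖ * ρ := by
        refine (neg_le_abs _).trans ((Complex.abs_re_le_norm _).trans ?_)
        rw [norm_mul]
        gcongr
      linarith
    have h1 : 1 ≤ (g * (x + w)).re := by
      rw [hX, div_le_iff₀ hg] at hxX
      linarith
    have hnorm : ‖g * (x + w)‖ ≤ ‖g‖ * x + ‖g‖ * ρ := by
      rw [norm_mul, ← mul_add]
      gcongr
      refine (norm_add_le _ _).trans ?_
      rw [Complex.norm_real, Real.norm_of_nonneg hx]
      gcongr
    have hexp1 : 1 ≤ Real.exp (g.re / 2 * x) := Real.one_le_exp (by positivity)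
    have hexp2 : x ≤ (2 / g.re) * Real.exp (g.re / 2 * x) := by
      have := Real.add_one_le_exp (g.re / 2 * x)
      rw [div_mul_eq_mul_div, le_div_iff₀ hg]
      linarith
    have hlin : 2 + ‖g * (x + w)‖ ≤
        (2 + ‖g‖ * ρ + ‖g‖ * (2 / g.re)) * Real.exp (g.re / 2 * x) := by
      have h3 : ‖g‖ * x ≤ ‖g‖ * ((2 / g.re) * Real.exp (g.re / 2 * x)) := by gcongr
      have h4 : 0 ≤ ‖g‖ * ρ := by positivity
      nlinarith
    calc _ ≤ 4 * (2 + ‖g * (x + w)‖) * Real.exp (-(g * (x + w)).re) :=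
          norm_genFactor_le_of_le_re h1
      _ ≤ 4 * ((2 + ‖g‖ * ρ + ‖g‖ * (2 / g.re)) * Real.exp (g.re / 2 * x)) *
          Real.exp (‖g‖ * ρ - g.re * x) := by
        gcongr
        linarith
      _ = D * Real.exp (-(g.re / 2) * x) := by
        rw [hD]
        have : Real.exp (g.re / 2 * x) * Real.exp (‖g‖ * ρ - g.re * x) =
          Real.exp (‖g‖ * ρ) * Real.exp (-(g.re / 2) * x) := by
          rw [← Real.exp_add, ← Real.exp_add]
          congr 1
          ring
        linear_combination 4 * (2 + ‖g‖ * ρ + ‖g‖ * (2 / g.re)) * this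
      _ ≤ _ := by
        rw [add_mul]
        exact le_add_of_nonneg_right (by positivity)

lemma kernel_eq {c : ℝ} (hc : c ≠ 0) {y : ℂ} (hy : y ≠ 0) :
    kernel c y = (bernoulliGen y - bernoulliGen (c * y)) / y := by
  have hc' : (c : ℂ) ≠ 0 := by exact_mod_cast hc
  rw [kernel, if_neg hy, bernoulliGen, if_neg hy, bernoulliGen, if_neg (mul_ne_zero hc' hy),
    sub_div]
  congr 1
  · rw [div_div, mul_comm, ← div_div, div_self hy]
  · rw [div_div, mul_comm (c : ℂ) y, mul_comm (Complex.exp _ - 1) y, mul_div_mul_left _ _ hy]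

lemma hasDerivAt_bernoulliGen_ofReal_mul {y : ℂ} {θ : ℝ} (h : (θ : ℂ) * y ∈ regularSet) :
    HasDerivAt (fun c : ℝ => bernoulliGen (c * y)) (genFactor (θ * y) * y) θ := by
  have h1 : HasDerivAt (fun c : ℝ => (c : ℂ) * y) (1 * y) θ :=
    (Complex.ofRealCLM.hasDerivAt (x := θ)).mul_const y
  rw [one_mul] at h1
  exact (hasDerivAt_bernoulliGen h).comp θ h1

/-- Mean value inequality for θ ↦ b(θy) between 1 and c. The chain rule factor y cancels the 1/y of
`kernel_eq`, so the bound does not degenerate near y = 0. -/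
lemma norm_kernel_le {c M : ℝ} (hc : 0 < c) {y : ℂ} (h : ∀ θ ∈ Set.uIcc 1 c,
    (θ : ℂ) * y ∈ regularSet ∧ ‖genFactor (θ * y)‖ ≤ M) : ‖kernel c y‖ ≤ |c - 1| * M := by
  by_cases hy : y = 0
  · subst hy
    have h1 := (h 1 Set.left_mem_uIcc).2
    rw [kernel, if_pos rfl, norm_div, ← Complex.ofReal_one, ← Complex.ofReal_sub,
      Complex.norm_real, Real.norm_eq_abs]
    simp only [genFactor, mul_zero, if_true] at h1
    norm_num at h1
    have := abs_nonneg (c - 1)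
    norm_num
    nlinarith
  · have h1 := Convex.norm_image_sub_le_of_norm_hasDerivWithin_le (𝕜 := ℝ) (C := M * ‖y‖)
      (f := fun c : ℝ => bernoulliGen (c * y)) (f' := fun θ => genFactor (θ * y) * y)
      (s := Set.uIcc 1 c) (x := c) (y := 1)
      (fun θ hθ => (hasDerivAt_bernoulliGen_ofReal_mul (h θ hθ).1).hasDerivWithinAt)
      (fun θ hθ => by
        rw [norm_mul]
        gcongr
        exact (h θ hθ).2)
      (convex_uIcc 1 c) Set.right_mem_uIcc Set.left_mem_uIcc
    rw [kernel_eq hc.ne' hy, norm_div, div_le_iff₀ (norm_pos_iff.mpr hy)]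
    simp only [Complex.ofReal_one, one_mul, Real.norm_eq_abs] at h1
    rw [abs_sub_comm 1 c] at h1
    linarith

lemma tendsto_kernel_div {y : ℂ} (hy : y ∈ regularSet) :
    Tendsto (fun c : ℝ => kernel c y / ((c : ℂ) - 1)) (𝓝[≠] 1) (𝓝 (-genFactor y)) := by
  by_cases h0 : y = 0
  · subst h0
    refine tendsto_const_nhds.congr' ?_
    filter_upwards [self_mem_nhdsWithin] with c hc
    have : (c : ℂ) - 1 ≠ 0 := sub_ne_zero.mpr (by exact_mod_cast hc)
    rw [kernel, if_pos rfl, genFactor, if_pos rfl]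
    field_simp
  · have hd := hasDerivAt_bernoulliGen_ofReal_mul (y := y) (θ := 1) (by simpa using hy)
    rw [hasDerivAt_iff_tendsto_slope] at hd
    have h2 := (hd.div_const y).neg
    simp only [Complex.ofReal_one, one_mul] at h2
    rw [mul_div_cancel_right₀ _ h0] at h2
    refine h2.congr' ?_
    have hpos : ∀ᶠ c : ℝ in 𝓝[≠] 1, c ≠ 0 :=
      nhdsWithin_le_nhds (isOpen_ne.mem_nhds one_ne_zero)
    filter_upwards [hpos] with c hc0
    rw [kernel_eq hc0 h0, slope_def_module, Complex.real_smul, Complex.ofReal_inv]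
    push_cast
    rw [one_mul]
    simp only [div_eq_mul_inv]
    ring

/-- The mean value inequality evaluates b' at θ(x + w) with 1/2 ≤ θ ≤ 2: the upper bound doubles the
radius ρ, the lower one halves the decay rate. -/
lemma exists_norm_kernel_le {g : ℂ} (hg : 0 < g.re) {ρ : ℝ} (hρ0 : 0 ≤ ρ)
    (hρ : 2 * ρ * Complex.normSq g < 2 * Real.pi * g.re) :
    ∃ M δ : ℝ, 0 ≤ M ∧ 0 < δ ∧ ∀ (x : ℝ) (w : ℂ), 0 ≤ x → ‖w‖ ≤ ρ →
      g * (x + w) ∈ regularSet ∧ ‖genFactor (g * (x + w))‖ ≤ M * Real.exp (-δ * x) ∧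
      ∀ c : ℝ, |c - 1| ≤ 1 / 2 →
        ‖kernel c (g * (x + w))‖ ≤ |c - 1| * (M * Real.exp (-δ * x)) := by
  obtain ⟨M, δ, hM, hδ, H⟩ := exists_norm_genFactor_le hg (ρ := 2 * ρ) (by positivity) hρ
  refine ⟨M, δ / 2, hM, by positivity, fun x w hx hw => ?_⟩
  have hθ : ∀ θ : ℝ, 1 / 2 ≤ θ → θ ≤ 2 → (θ : ℂ) * (g * (x + w)) ∈ regularSet ∧
      ‖genFactor (θ * (g * (x + w)))‖ ≤ M * Real.exp (-(δ / 2) * x) := by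
    intro θ h1 h2
    have h0 : 0 ≤ θ := by linarith
    have h3 := H (θ * x) (θ * w) (by positivity) (by
      rw [norm_mul, Complex.norm_real, Real.norm_of_nonneg h0]
      gcongr)
    have h4 : (θ : ℂ) * (g * (x + w)) = g * ((θ * x : ℝ) + θ * w) := by push_cast; ring
    rw [h4]
    refine ⟨h3.1, h3.2.trans ?_⟩
    refine mul_le_mul_of_nonneg_left (Real.exp_le_exp.mpr ?_) hM
    nlinarith [mul_nonneg hδ.le hx]
  have h1 := hθ 1 (by norm_num) (by norm_num)
  rw [Complex.ofReal_one, one_mul] at h1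
  refine ⟨h1.1, h1.2, fun c hc => ?_⟩
  rw [abs_le] at hc
  refine norm_kernel_le (by linarith) fun θ hθ' => hθ θ ?_ ?_
  · rcases Set.mem_uIcc.mp hθ' with h | h <;> linarith
  · rcases Set.mem_uIcc.mp hθ' with h | h <;> linarith

/-! ### Measurability and estimates along the Hankel contour. -/

lemma measurable_genFactor : Measurable genFactor := by
  unfold genFactor
  exact Measurable.ite (measurableSet_singleton 0) measurable_const (by fun_prop)

lemma measurable_kernel (c : ℝ) : Measurable (kernel c) := by
  unfold kernel
  exact Measurable.ite (measurableSet_singleton 0) measurable_const (by fun_prop)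

/-- The distance travelled along the real axis, outside the circle of radius `ε`, at the time
`u` on the Hankel contour. -/
noncomputable def hankelDist (u : ℝ) : ℝ := max (-u) (max 0 (u - 2 * Real.pi))

lemma hankelDist_nonneg (u : ℝ) : 0 ≤ hankelDist u :=
  le_max_of_le_right (le_max_left _ _)

lemma abs_sub_le_hankelDist (u : ℝ) : |u| - 2 * Real.pi ≤ hankelDist u := by
  have h1 : -u ≤ hankelDist u := le_max_left _ _
  have h2 : u - 2 * Real.pi ≤ hankelDist u := (le_max_right _ _).trans (le_max_right _ _)
  have := Real.pi_pos
  rcases abs_cases u with h | h <;> linarith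

lemma hankelDist_of_neg {u : ℝ} (h : u < 0) : hankelDist u = -u := by
  have := Real.pi_pos
  rw [hankelDist, max_eq_left]
  exact max_le (by linarith) (by linarith)

lemma hankelDist_of_mem {u : ℝ} (h0 : 0 ≤ u) (h : u ≤ 2 * Real.pi) : hankelDist u = 0 := by
  rw [hankelDist, max_eq_left (a := (0 : ℝ)) (by linarith), max_eq_right (by linarith)]

lemma hankelDist_of_gt {u : ℝ} (h : 2 * Real.pi < u) : hankelDist u = u - 2 * Real.pi := by
  have := Real.pi_pos
  rw [hankelDist, max_eq_right (a := (0 : ℝ)) (by linarith), max_eq_right (by linarith)]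

lemma measurable_hankelDist : Measurable hankelDist := by
  unfold hankelDist
  fun_prop

lemma measurable_hankelPath (ε : ℝ) : Measurable (hankelPath ε) := by
  unfold hankelPath
  exact Measurable.ite measurableSet_Iio (by fun_prop)
    (Measurable.ite measurableSet_Iic (by fun_prop) (by fun_prop))

lemma measurable_hankelVel (ε : ℝ) : Measurable (hankelVel ε) := by
  unfold hankelVel
  exact Measurable.ite measurableSet_Iio (by fun_prop)
    (Measurable.ite measurableSet_Iic (by fun_prop) (by fun_prop))

lemma measurable_hankelLog (ε : ℝ) : Measurable (hankelLog ε) := by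
  unfold hankelLog
  exact Measurable.ite measurableSet_Iio (by fun_prop)
    (Measurable.ite measurableSet_Iic (by fun_prop) (by fun_prop))

/-- Hence T_j is within rε of a non-negative real number, which is the form x + w of the decay
estimates. -/
lemma norm_hankelPath_sub_le {ε : ℝ} (hε : 0 < ε) (u : ℝ) :
    ‖hankelPath ε u - hankelDist u‖ ≤ ε := by
  rw [hankelPath]
  split_ifs with h1 h2
  · rw [hankelDist_of_neg h1, ← Complex.ofReal_sub, Complex.norm_real, Real.norm_eq_abs,
      show ε - u - -u = ε by ring, abs_of_pos hε]
  · rw [hankelDist_of_mem (not_lt.mp h1) h2, Complex.ofReal_zero, sub_zero, norm_mul,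
      Complex.norm_real, mul_comm Complex.I, Complex.norm_exp_ofReal_mul_I, Real.norm_eq_abs,
      abs_of_pos hε, mul_one]
  · rw [hankelDist_of_gt (not_le.mp h2), ← Complex.ofReal_sub, Complex.norm_real,
      Real.norm_eq_abs, add_sub_cancel_right, abs_of_pos hε]

lemma norm_hankelVel_le {ε : ℝ} (hε : 0 < ε) (u : ℝ) : ‖hankelVel ε u‖ ≤ 1 + ε := by
  rw [hankelVel]
  split_ifs with h1 h2
  · rw [norm_neg, norm_one]
    linarith
  · rw [norm_mul, norm_mul, Complex.norm_I, one_mul,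
      Complex.norm_real, mul_comm Complex.I, Complex.norm_exp_ofReal_mul_I, Real.norm_eq_abs,
      abs_of_pos hε]
    linarith
  · rw [norm_one]
    linarith

lemma norm_hankelLog_le (ε u : ℝ) :
    ‖hankelLog ε u‖ ≤ |Real.log (ε + hankelDist u)| + 2 * Real.pi := by
  have hpi := Real.two_pi_pos
  rw [hankelLog]
  split_ifs with h1 h2
  · rw [hankelDist_of_neg h1, Complex.norm_real, Real.norm_eq_abs, sub_eq_add_neg]
    linarith
  · rw [hankelDist_of_mem (not_lt.mp h1) h2, add_zero]
    refine (norm_add_le _ _).trans ?_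
    rw [norm_mul, Complex.norm_I, one_mul, Complex.norm_real, Complex.norm_real,
      Real.norm_eq_abs, Real.norm_eq_abs, abs_of_nonneg (not_lt.mp h1)]
    gcongr
  · rw [hankelDist_of_gt (not_le.mp h2)]
    refine (norm_add_le _ _).trans ?_
    rw [norm_mul, Complex.norm_I, one_mul, Complex.norm_real, Real.norm_eq_abs]
    simp [abs_of_pos Real.pi_pos]

lemma exp_hankelLog {ε : ℝ} (hε : 0 < ε) (u : ℝ) :
    Complex.exp (hankelLog ε u) = hankelPath ε u := by
  rw [hankelLog, hankelPath]
  split_ifs with h1 h2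
  · rw [← Complex.ofReal_exp, Real.exp_log (by linarith)]
  · rw [Complex.exp_add, ← Complex.ofReal_exp, Real.exp_log hε]
  · rw [Complex.exp_add, ← Complex.ofReal_exp, Real.exp_log (by linarith), mul_comm Complex.I,
      Complex.exp_two_pi_mul_I, mul_one]

lemma abs_log_add_le {ε η : ℝ} (hε : 0 < ε) (hη : 0 < η) :
    ∃ C : ℝ, ∀ x, 0 ≤ x → |Real.log (ε + x)| ≤ η * x + C := by
  refine ⟨η * ε + |Real.log η| + |Real.log ε|, fun x hx => ?_⟩
  have h1 := Real.log_le_sub_one_of_pos (x := η * (ε + x)) (by positivity)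
  rw [Real.log_mul hη.ne' (by positivity)] at h1
  have h2 : Real.log ε ≤ Real.log (ε + x) := Real.log_le_log hε (by linarith)
  have h3 := neg_abs_le (Real.log η)
  have h4 := neg_abs_le (Real.log ε)
  have h5 : 0 ≤ η * x := by positivity
  have h6 : 0 ≤ η * ε := by positivity
  have h7 := abs_nonneg (Real.log η)
  have h8 := abs_nonneg (Real.log ε)
  rw [abs_le]
  constructor <;> linarith

lemma integrable_exp_neg_mul_abs {a : ℝ} (ha : 0 < a) :
    Integrable fun u : ℝ => Real.exp (-a * |u|) := by
  have h1 : IntegrableOn (fun u : ℝ => Real.exp (-a * |u|)) (Set.Ioi 0) :=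
    (exp_neg_integrableOn_Ioi 0 ha).congr_fun
      (fun u hu => by simp only [abs_of_pos (Set.mem_Ioi.mp hu)]) measurableSet_Ioi
  have h2 : IntegrableOn (fun u : ℝ => Real.exp (-a * |u|)) (Set.Iic 0) :=
    (integrableOn_exp_mul_Iic ha 0).congr_fun
      (fun u hu => by simp only [abs_of_nonpos (Set.mem_Iic.mp hu), neg_mul_neg])
      measurableSet_Iic
  rw [← integrableOn_univ, ← Set.Iic_union_Ioi (a := (0 : ℝ))]
  exact h2.union h1

lemma integrable_exp_hankelLog_mul {ε δ K : ℝ} (hε : 0 < ε) (hδ : 0 < δ) (hK : 0 ≤ K) :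
    Integrable fun u : ℝ => Real.exp (K * ‖hankelLog ε u‖) * Real.exp (-δ * hankelDist u) := by
  -- With this slope for the logarithm, the power of t costs at most half of the decay rate δ; the +
  -- 1 covers K = 0.
  have hη : 0 < δ / (2 * (K + 1)) := by positivity
  obtain ⟨C, hC⟩ := abs_log_add_le hε hη
  refine Integrable.mono' ((integrable_exp_neg_mul_abs (half_pos hδ)).const_mul
    (Real.exp (K * (C + 2 * Real.pi) + δ * Real.pi))) ?_ (ae_of_all _ fun u => ?_)
  · have := measurable_hankelLog ε
    have := measurable_hankelDist
    exact Measurable.aestronglyMeasurable (by fun_prop)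
  · rw [Real.norm_of_nonneg (by positivity), ← Real.exp_add, ← Real.exp_add, Real.exp_le_exp]
    have h1 := norm_hankelLog_le ε u
    have h2 := hC _ (hankelDist_nonneg u)
    have h3 := abs_sub_le_hankelDist u
    have h4 : K * (δ / (2 * (K + 1)) * hankelDist u) ≤ δ / 2 * hankelDist u := by
      rw [← mul_assoc]
      refine mul_le_mul_of_nonneg_right ?_ (hankelDist_nonneg u)
      rw [mul_div_assoc', div_le_iff₀ (by positivity)]
      nlinarith
    have h5 : K * ‖hankelLog ε u‖ ≤
        K * (δ / (2 * (K + 1)) * hankelDist u + C + 2 * Real.pi) :=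
      mul_le_mul_of_nonneg_left (by linarith) hK
    have h6 : δ / 2 * (|u| - 2 * Real.pi) ≤ δ / 2 * hankelDist u :=
      mul_le_mul_of_nonneg_left h3 (by positivity)
    nlinarith

lemma norm_exp_hankelLog_mul_vel_le {ε K : ℝ} (hε : 0 < ε) {s : ℂ} (hs : ‖s - 1‖ ≤ K) (u : ℝ) :
    ‖Complex.exp ((s - 1) * hankelLog ε u) * hankelVel ε u‖ ≤
      Real.exp (K * ‖hankelLog ε u‖) * (1 + ε) := by
  rw [norm_mul, Complex.norm_exp]
  refine mul_le_mul (Real.exp_le_exp.mpr ?_) (norm_hankelVel_le hε u) (norm_nonneg _)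
    (Real.exp_nonneg _)
  refine (Complex.re_le_norm _).trans ?_
  rw [norm_mul]
  gcongr

/-- The j-th factor decays in the whole tail sum, but only the decay in `u j` is kept: the product
of the bounds then splits into functions of one variable each. -/
lemma exists_hankel_bounds {r : ℕ} {γ : Fin r → ℂ} (hγ : ∀ j, 0 < (γ j).re) {ε : ℝ} (hε : 0 < ε)
    (hρ : ∀ j, 2 * (r * ε) * Complex.normSq (γ j) < 2 * Real.pi * (γ j).re) :
    ∃ M δ : Fin r → ℝ, (∀ j, 0 ≤ M j) ∧ (∀ j, 0 < δ j) ∧ ∀ (u : Fin r → ℝ) (j : Fin r),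
      γ j * tailSum (fun k => hankelPath ε (u k)) j ∈ regularSet ∧
      ‖genFactor (γ j * tailSum (fun k => hankelPath ε (u k)) j)‖ ≤
        M j * Real.exp (-δ j * hankelDist (u j)) ∧
      ∀ c : ℝ, |c - 1| ≤ 1 / 2 → ‖kernel c (γ j * tailSum (fun k => hankelPath ε (u k)) j)‖ ≤
        |c - 1| * (M j * Real.exp (-δ j * hankelDist (u j))) := by
  choose M δ hM hδ H using fun j =>
    exists_norm_kernel_le (hγ j) (ρ := r * ε) (by positivity) (hρ j)
  refine ⟨M, δ, hM, hδ, fun u j => ?_⟩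
  set x : ℝ := ∑ k ∈ Finset.Ici j, hankelDist (u k) with hx
  have hx0 : hankelDist (u j) ≤ x :=
    Finset.single_le_sum (f := fun k => hankelDist (u k)) (fun k _ => hankelDist_nonneg _)
      (Finset.mem_Ici.mpr le_rfl)
  have hw : ‖tailSum (fun k => hankelPath ε (u k)) j - x‖ ≤ r * ε := by
    rw [tailSum, hx, Complex.ofReal_sum, ← Finset.sum_sub_distrib]
    refine (norm_sum_le _ _).trans ((Finset.sum_le_sum fun k _ =>
      norm_hankelPath_sub_le hε (u k)).trans ?_)
    rw [Finset.sum_const, nsmul_eq_mul]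
    gcongr
    exact_mod_cast (Finset.card_le_univ _).trans (by simp)
  have h := H j x _ ((hankelDist_nonneg _).trans hx0) hw
  rw [add_sub_cancel] at h
  have hle : M j * Real.exp (-δ j * x) ≤ M j * Real.exp (-δ j * hankelDist (u j)) := by
    refine mul_le_mul_of_nonneg_left (Real.exp_le_exp.mpr ?_) (hM j)
    nlinarith [hδ j]
  exact ⟨h.1, h.2.1.trans hle, fun c hc => (h.2.2 c hc).trans
    (mul_le_mul_of_nonneg_left hle (abs_nonneg _))⟩

/-! ### The limit c → 1 under the integral, and continuity in s. -/

/-- The limit of the integrand, divided by `(1 - c)^r`, as `c → 1`. -/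
noncomputable def limIntegrand {r : ℕ} (ε : ℝ) (γ : Fin r → ℂ) (s : Fin r → ℂ)
    (u : Fin r → ℝ) : ℂ :=
  (∏ j, genFactor (γ j * tailSum (fun k => hankelPath ε (u k)) j)) *
    ∏ k, (Complex.exp ((s k - 1) * hankelLog ε (u k)) * hankelVel ε (u k))

lemma measurable_tailSum_hankelPath {r : ℕ} (ε : ℝ) (j : Fin r) :
    Measurable fun u : Fin r → ℝ => tailSum (fun k => hankelPath ε (u k)) j := by
  unfold tailSum
  exact Finset.measurable_fun_sum _ fun k _ => (measurable_hankelPath ε).comp (measurable_pi_apply k)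

lemma measurable_prod_hankel {r : ℕ} (ε : ℝ) (s : Fin r → ℂ) : Measurable fun u : Fin r → ℝ =>
    ∏ k, (Complex.exp ((s k - 1) * hankelLog ε (u k)) * hankelVel ε (u k)) := by
  have h1 := measurable_hankelLog ε
  have h2 := measurable_hankelVel ε
  fun_prop

lemma measurable_integrand {r : ℕ} (ε : ℝ) (γ : Fin r → ℂ) (c : ℝ) (s : Fin r → ℂ) :
    Measurable (integrand ε γ c s) := by
  refine Measurable.mul ?_ (measurable_prod_hankel ε s)
  unfold tildeH
  exact Finset.measurable_fun_prod _ fun j _ =>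
    (measurable_kernel c).comp ((measurable_tailSum_hankelPath ε j).const_mul _)

lemma measurable_limIntegrand {r : ℕ} (ε : ℝ) (γ : Fin r → ℂ) (s : Fin r → ℂ) :
    Measurable (limIntegrand ε γ s) := by
  refine Measurable.mul ?_ (measurable_prod_hankel ε s)
  exact Finset.measurable_fun_prod _ fun j _ =>
    measurable_genFactor.comp ((measurable_tailSum_hankelPath ε j).const_mul _)

/-- A common integrable majorant of the integrands for all `c` near `1` and all bounded `s`. -/
lemma exists_integrable_majorant {r : ℕ} {γ : Fin r → ℂ} (hγ : ∀ j, 0 < (γ j).re) {ε : ℝ}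
    (hε : 0 < ε) (hρ : ∀ j, 2 * (r * ε) * Complex.normSq (γ j) < 2 * Real.pi * (γ j).re)
    {K : ℝ} (hK : 0 ≤ K) :
    ∃ B : (Fin r → ℝ) → ℝ, Integrable B ∧ ∀ (s : Fin r → ℂ), (∀ k, ‖s k - 1‖ ≤ K) → ∀ u,
      ‖limIntegrand ε γ s u‖ ≤ B u ∧
      ∀ c : ℝ, |c - 1| ≤ 1 / 2 → ‖integrand ε γ c s u‖ ≤ |c - 1| ^ r * B u := by
  obtain ⟨M, δ, hM, hδ, H⟩ := exists_hankel_bounds hγ hε hρ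
  refine ⟨fun u => ∏ j, (M j * Real.exp (-δ j * hankelDist (u j)) *
    (Real.exp (K * ‖hankelLog ε (u j)‖) * (1 + ε))), ?_, fun s hs u => ⟨?_, fun c hc => ?_⟩⟩
  · refine Integrable.fintype_prod (f := fun j u => M j * Real.exp (-δ j * hankelDist u) *
      (Real.exp (K * ‖hankelLog ε u‖) * (1 + ε))) fun j => ?_
    refine ((integrable_exp_hankelLog_mul hε (hδ j) hK).const_mul (M j * (1 + ε))).congr
      (ae_of_all _ fun u => ?_)
    ring
  · rw [limIntegrand, norm_mul, norm_prod, norm_prod, ← Finset.prod_mul_distrib]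
    refine Finset.prod_le_prod (fun j _ => by positivity) fun j _ => ?_
    exact mul_le_mul (H u j).2.1 (norm_exp_hankelLog_mul_vel_le hε (hs j) _) (norm_nonneg _)
      (mul_nonneg (hM j) (Real.exp_nonneg _))
  · have hr : |c - 1| ^ r = ∏ _j : Fin r, |c - 1| := by simp
    rw [integrand, tildeH, norm_mul, norm_prod, norm_prod, ← Finset.prod_mul_distrib, hr,
      ← Finset.prod_mul_distrib]
    refine Finset.prod_le_prod (fun j _ => by positivity) fun j _ => ?_
    rw [← mul_assoc]
    exact mul_le_mul ((H u j).2.2 c hc) (norm_exp_hankelLog_mul_vel_le hε (hs j) _) (norm_nonneg _)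
      (mul_nonneg (abs_nonneg _) (mul_nonneg (hM j) (Real.exp_nonneg _)))

lemma eventually_abs_sub_one_le : ∀ᶠ c : ℝ in 𝓝[≠] 1, |c - 1| ≤ 1 / 2 := by
  refine nhdsWithin_le_nhds ?_
  filter_upwards [Metric.closedBall_mem_nhds (1 : ℝ) (by norm_num : (0 : ℝ) < 1 / 2)] with c hc
  rwa [← Real.dist_eq]

lemma exists_norm_sub_one_le {r : ℕ} (s : Fin r → ℂ) : ∃ K : ℝ, 0 ≤ K ∧ ∀ k, ‖s k - 1‖ ≤ K :=
  ⟨∑ k, ‖s k - 1‖, by positivity, fun k =>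
    Finset.single_le_sum (f := fun k => ‖s k - 1‖) (fun _ _ => norm_nonneg _) (Finset.mem_univ k)⟩

/-- The factor in front of the contour integral, without the power of `c - 1`. -/
noncomputable def hankelFactor {r : ℕ} (s : Fin r → ℂ) : ℂ :=
  ∏ k, 1 / ((Complex.exp (2 * Real.pi * Complex.I * s k) - 1) * Complex.Gamma (s k))

lemma eventually_integrable_integrand {r : ℕ} {γ : Fin r → ℂ} (hγ : ∀ j, 0 < (γ j).re) {ε : ℝ}
    (hε : 0 < ε) (hρ : ∀ j, 2 * (r * ε) * Complex.normSq (γ j) < 2 * Real.pi * (γ j).re)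
    (s : Fin r → ℂ) : ∀ᶠ c in 𝓝[≠] (1 : ℝ), Integrable (integrand ε γ c s) := by
  obtain ⟨K, hK, hs⟩ := exists_norm_sub_one_le s
  obtain ⟨B, hB, H⟩ := exists_integrable_majorant hγ hε hρ hK
  filter_upwards [eventually_abs_sub_one_le] with c hc
  exact Integrable.mono' (hB.const_mul _) (measurable_integrand ε γ c s).aestronglyMeasurable
    (ae_of_all _ fun u => (H s hs u).2 c hc)

lemma tendsto_approx {r : ℕ} {γ : Fin r → ℂ} (hγ : ∀ j, 0 < (γ j).re) {ε : ℝ}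
    (hε : 0 < ε) (hρ : ∀ j, 2 * (r * ε) * Complex.normSq (γ j) < 2 * Real.pi * (γ j).re)
    (s : Fin r → ℂ) : Tendsto (fun c => approx ε γ c s) (𝓝[≠] (1 : ℝ))
      (𝓝 (hankelFactor s * ∫ u, limIntegrand ε γ s u)) := by
  obtain ⟨K, hK, hs⟩ := exists_norm_sub_one_le s
  obtain ⟨B, hB, H⟩ := exists_integrable_majorant hγ hε hρ hK
  obtain ⟨_, _, _, _, hreg⟩ := exists_hankel_bounds hγ hε hρ
  have hlim : Tendsto (fun c : ℝ => ∫ u, (-1) ^ r / ((c : ℂ) - 1) ^ r * integrand ε γ c s u)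
      (𝓝[≠] (1 : ℝ)) (𝓝 (∫ u, limIntegrand ε γ s u)) := by
    refine tendsto_integral_filter_of_dominated_convergence B
      (Eventually.of_forall fun c =>
        ((measurable_integrand ε γ c s).const_mul _).aestronglyMeasurable) ?_ hB
      (ae_of_all _ fun u => ?_)
    · filter_upwards [eventually_abs_sub_one_le, self_mem_nhdsWithin] with c hc hne
      refine ae_of_all _ fun u => ?_
      have hpos : 0 < |c - 1| := abs_pos.mpr (sub_ne_zero.mpr hne)
      rw [norm_mul, norm_div, norm_pow, norm_pow, norm_neg, norm_one, one_pow,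
        ← Complex.ofReal_one, ← Complex.ofReal_sub, Complex.norm_real, Real.norm_eq_abs,
        one_div, inv_mul_le_iff₀ (by positivity)]
      exact (H s hs u).2 c hc
    -- One factor -1/(c - 1) is handed to each of the r kernels.
    · have h1 : ∀ c : ℝ, (-1) ^ r / ((c : ℂ) - 1) ^ r * integrand ε γ c s u =
          (∏ j, -(kernel c (γ j * tailSum (fun k => hankelPath ε (u k)) j) / ((c : ℂ) - 1))) *
          ∏ k, (Complex.exp ((s k - 1) * hankelLog ε (u k)) * hankelVel ε (u k)) := by
        intro c
        rw [integrand, tildeH, ← mul_assoc]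
        congr 1
        simp_rw [← neg_div, Finset.prod_div_distrib, Finset.prod_neg, Finset.prod_const]
        rw [Finset.card_univ, Fintype.card_fin]
        ring
      simp_rw [h1]
      refine Tendsto.mul_const _ (tendsto_finsetProd _ fun j _ => ?_)
      have := (tendsto_kernel_div (hreg u j).1).neg
      rwa [neg_neg] at this
  refine (hlim.const_mul (hankelFactor s)).congr fun c => ?_
  rw [integral_const_mul, approx, hankelFactor]
  ring

lemma generic_eq {r : ℕ} {γ : Fin r → ℂ} (hγ : ∀ j, 0 < (γ j).re) {ε : ℝ}
    (hε : 0 < ε) (hρ : ∀ j, 2 * (r * ε) * Complex.normSq (γ j) < 2 * Real.pi * (γ j).re)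
    (s : Fin r → ℂ) : generic ε γ s = hankelFactor s * ∫ u, limIntegrand ε γ s u :=
  (tendsto_approx hγ hε hρ s).limUnder_eq

lemma continuous_integral_limIntegrand {r : ℕ} {γ : Fin r → ℂ} (hγ : ∀ j, 0 < (γ j).re) {ε : ℝ}
    (hε : 0 < ε) (hρ : ∀ j, 2 * (r * ε) * Complex.normSq (γ j) < 2 * Real.pi * (γ j).re) :
    Continuous fun s : Fin r → ℂ => ∫ u, limIntegrand ε γ s u := by
  rw [continuous_iff_continuousAt]
  intro s₀
  obtain ⟨K, hK, hs₀⟩ := exists_norm_sub_one_le s₀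
  -- K + 1 lets one majorant serve the whole unit ball around s₀.
  obtain ⟨B, hB, H⟩ := exists_integrable_majorant hγ hε hρ (K := K + 1) (by positivity)
  refine continuousAt_of_dominated (bound := B)
    (Eventually.of_forall fun s => (measurable_limIntegrand ε γ s).aestronglyMeasurable) ?_ hB
    (ae_of_all _ fun u => ?_)
  · filter_upwards [Metric.ball_mem_nhds s₀ one_pos] with s hs
    refine ae_of_all _ fun u => (H s (fun k => ?_) u).1
    have h1 : ‖s k - s₀ k‖ ≤ 1 := by
      rw [← dist_eq_norm]
      exact (dist_le_pi_dist s s₀ k).trans (Metric.mem_ball.mp hs).le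
    calc ‖s k - 1‖ = ‖(s k - s₀ k) + (s₀ k - 1)‖ := by rw [sub_add_sub_cancel]
      _ ≤ ‖s k - s₀ k‖ + ‖s₀ k - 1‖ := norm_add_le _ _
      _ ≤ K + 1 := by linarith [hs₀ k]
  · exact (continuous_const.mul (continuous_finsetProd _ fun k _ => by fun_prop)).continuousAt

/-! ### The prefactor near non-positive integer points. -/

/-- Combines e^{2πis} - 1 = 2i e^{πis} sin(πs) with the reflection formula. The right side is
continuous at s = -m, where the left side is a product of the form 0 · ∞ in the denominator. -/
lemma exp_two_pi_sub_one_mul_Gamma {s : ℂ} (hs : ∀ n : ℤ, s ≠ n) :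
    1 / ((Complex.exp (2 * Real.pi * Complex.I * s) - 1) * Complex.Gamma s) =
      Complex.Gamma (1 - s) * Complex.exp (-(Real.pi * Complex.I * s)) /
        (2 * Real.pi * Complex.I) := by
  have hpi : (Real.pi : ℂ) ≠ 0 := by exact_mod_cast Real.pi_ne_zero
  have hsin : Complex.sin (Real.pi * s) ≠ 0 := by
    rw [Complex.sin_ne_zero_iff]
    intro n hn
    rw [mul_comm (n : ℂ)] at hn
    exact hs n (mul_left_cancel₀ hpi hn)
  have h1 : (Complex.exp (2 * Real.pi * Complex.I * s) - 1) *
      Complex.exp (-(Real.pi * Complex.I * s)) = 2 * Complex.I * Complex.sin (Real.pi * s) := by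
    rw [sub_mul, ← Complex.exp_add, one_mul, Complex.sin]
    rw [show 2 * Real.pi * Complex.I * s + -(Real.pi * Complex.I * s) = Real.pi * s * Complex.I by
      ring, show -(Real.pi * Complex.I * s) = -(Real.pi * s) * Complex.I by ring]
    linear_combination (Complex.exp (-(Real.pi * s) * Complex.I) -
      Complex.exp (Real.pi * s * Complex.I)) * Complex.I_sq.symm
  have h2 := Complex.Gamma_mul_Gamma_one_sub s
  have h3 : ((Complex.exp (2 * Real.pi * Complex.I * s) - 1) * Complex.Gamma s) *
      (Complex.Gamma (1 - s) * Complex.exp (-(Real.pi * Complex.I * s))) =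
        2 * Real.pi * Complex.I := by
    calc _ = ((Complex.exp (2 * Real.pi * Complex.I * s) - 1) *
          Complex.exp (-(Real.pi * Complex.I * s))) *
          (Complex.Gamma s * Complex.Gamma (1 - s)) := by ring
      _ = _ := by
        rw [h1, h2]
        field_simp
  have h4 : (2 * Real.pi * Complex.I : ℂ) ≠ 0 := Complex.two_pi_I_ne_zero
  have h5 : ((Complex.exp (2 * Real.pi * Complex.I * s) - 1) * Complex.Gamma s) ≠ 0 := by
    intro h
    rw [h, zero_mul] at h3
    exact h4 h3.symm
  rw [div_eq_div_iff h5 h4, one_mul, mul_comm (Complex.Gamma _ * _), h3]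

lemma tendsto_hankelFactor {r : ℕ} (m : Fin r → ℕ) :
    Tendsto hankelFactor (𝓝[nonIntegral r] fun j => -(m j : ℂ))
      (𝓝 (∏ k, ((-1) ^ m k * ((m k).factorial : ℂ) / (2 * Real.pi * Complex.I)))) := by
  have h : Tendsto (fun s : Fin r → ℂ => ∏ k, (Complex.Gamma (1 - s k) *
      Complex.exp (-(Real.pi * Complex.I * s k)) / (2 * Real.pi * Complex.I)))
      (𝓝 fun j => -(m j : ℂ)) (𝓝 (∏ k, ((-1) ^ m k * ((m k).factorial : ℂ) /
        (2 * Real.pi * Complex.I)))) := by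
    refine tendsto_finsetProd _ fun k _ => ?_
    have h1 : ContinuousAt (fun z : ℂ => Complex.Gamma (1 - z) *
        Complex.exp (-(Real.pi * Complex.I * z)) / (2 * Real.pi * Complex.I)) (-(m k : ℂ)) := by
      have hG : ContinuousAt Complex.Gamma (1 - -(m k : ℂ)) := by
        refine (Complex.differentiableAt_Gamma _ fun n hn => ?_).continuousAt
        have : ((1 + m k + n : ℕ) : ℂ) = 0 := by
          push_cast
          linear_combination hn
        have := Nat.cast_eq_zero.mp this
        omega
      have hG' : ContinuousAt (fun z : ℂ => Complex.Gamma (1 - z)) (-(m k : ℂ)) :=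
        ContinuousAt.comp (f := fun z : ℂ => 1 - z) hG (by fun_prop)
      exact (hG'.mul (by fun_prop)).div_const _
    have h2 := h1.tendsto.comp
      ((continuous_apply k).tendsto (fun j => -(m j : ℂ) : Fin r → ℂ))
    have h3 : Complex.Gamma (1 - -(m k : ℂ)) * Complex.exp (-(Real.pi * Complex.I * -(m k : ℂ))) =
        (-1) ^ m k * ((m k).factorial : ℂ) := by
      rw [sub_neg_eq_add, add_comm, Complex.Gamma_nat_eq_factorial, mul_comm,
        show -(Real.pi * Complex.I * -(m k : ℂ)) = (m k : ℂ) * (Real.pi * Complex.I) by ring,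
        Complex.exp_nat_mul, Complex.exp_pi_mul_I]
    rw [h3] at h2
    exact h2
  refine (h.mono_left nhdsWithin_le_nhds).congr' ?_
  filter_upwards [self_mem_nhdsWithin] with s hs
  exact Finset.prod_congr rfl fun k _ => (exp_two_pi_sub_one_mul_Gamma (hs k)).symm

/-- Without it the limit defining the continuation would not be unique. The point is approached
along the diagonal, with the same 0 < τ < 1 added to every coordinate. -/
lemma neBot_nhdsWithin_nonIntegral {r : ℕ} (m : Fin r → ℕ) :
    (𝓝[nonIntegral r] fun j => -(m j : ℂ)).NeBot := by
  rw [← mem_closure_iff_nhdsWithin_neBot]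
  have h : Tendsto (fun τ : ℝ => fun j : Fin r => -(m j : ℂ) + (τ : ℂ)) (𝓝[>] 0)
      (𝓝 fun j => -(m j : ℂ)) := by
    have hc : Continuous fun τ : ℝ => fun j : Fin r => -(m j : ℂ) + (τ : ℂ) := by fun_prop
    have := hc.tendsto 0
    simp only [Complex.ofReal_zero, add_zero] at this
    exact this.mono_left nhdsWithin_le_nhds
  refine mem_closure_of_tendsto h ?_
  filter_upwards [Ioo_mem_nhdsGT (zero_lt_one (α := ℝ))] with τ hτ k n hn
  have h1 : τ = ((n + m k : ℤ) : ℝ) := by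
    have h2 : (τ : ℂ) = ((n + m k : ℤ) : ℂ) := by
      push_cast
      linear_combination hn
    exact_mod_cast h2
  have h0 := hτ.1
  have h1' := hτ.2
  rw [h1] at h0 h1'
  have a : 0 < n + m k := by exact_mod_cast h0
  have b : n + m k < 1 := by exact_mod_cast h1'
  omega

/-! ### Cancellation of the two rays at integer points. -/

/-- Reflection of the `k`-th coordinate in `a / 2`. -/
noncomputable def reflectCoord {r : ℕ} (a : ℝ) (k : Fin r) (u : Fin r → ℝ) : Fin r → ℝ :=
  fun i => if i = k then a - u i else u i

lemma involutive_reflectCoord {r : ℕ} (a : ℝ) (k : Fin r) :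
    Function.Involutive (reflectCoord a k) := by
  intro u
  ext i
  by_cases h : i = k <;> simp [reflectCoord, h]

lemma measurePreserving_reflectCoord {r : ℕ} (a : ℝ) (k : Fin r) :
    MeasurePreserving (reflectCoord a k) := by
  have h := measurePreserving_pi (fun _ : Fin r => (volume : Measure ℝ)) (fun _ => volume)
    (f := fun i x => if i = k then a - x else x) fun i => by
      by_cases hi : i = k
      · simpa [hi] using Measure.measurePreserving_sub_left (volume : Measure ℝ) a
      · simp only [hi, if_false]
        exact MeasurePreserving.id (volume : Measure ℝ)
  exact h

/-- An integrable function that changes sign under the reflection of each coordinate outside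
`[0, a]` has the same integral over the whole space as over the cube. -/
lemma integral_eq_setIntegral_of_reflect {r : ℕ} {F : (Fin r → ℝ) → ℂ} (hF : Integrable F) (a : ℝ)
    (hflip : ∀ (u : Fin r → ℝ) k, u k ∉ Set.Icc 0 a → F (reflectCoord a k u) = -F u) :
    ∫ u, F u = ∫ u in Set.univ.pi fun _ => Set.Icc 0 a, F u := by
  have key : ∀ S : Finset (Fin r), ∫ u, F u = ∫ u in {u | ∀ k ∈ S, u k ∈ Set.Icc 0 a}, F u := by
    intro S
    induction S using Finset.induction_on with
    | empty => simp
    | insert k S hk ih =>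
      rw [ih]
      set A : Set (Fin r → ℝ) := {u | ∀ k ∈ S, u k ∈ Set.Icc 0 a}
      set B : Set (Fin r → ℝ) := {u | u k ∈ Set.Icc 0 a}
      have hB : MeasurableSet B := measurable_pi_apply k measurableSet_Icc
      have hAB : {u : Fin r → ℝ | ∀ j ∈ insert k S, u j ∈ Set.Icc 0 a} = A ∩ B := by
        ext u
        simp only [Finset.mem_insert, forall_eq_or_imp, A, B, Set.mem_inter_iff, Set.mem_ofPred_eq]
        exact and_comm
      have hA : MeasurableSet A := by
        have : A = ⋂ k ∈ S, (fun u : Fin r → ℝ => u k) ⁻¹' Set.Icc 0 a := by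
          ext u
          simp [A]
        rw [this]
        exact Finset.measurableSet_biInter S fun k _ => measurable_pi_apply k measurableSet_Icc
      have hpre : reflectCoord a k ⁻¹' (A \ B) = A \ B := by
        ext u
        have h1 : reflectCoord a k u ∈ A ↔ u ∈ A := by
          refine forall₂_congr fun j hj => ?_
          have : j ≠ k := fun h => hk (h ▸ hj)
          simp [reflectCoord, this]
        have h2 : reflectCoord a k u ∈ B ↔ u ∈ B := by
          simp only [B, Set.mem_ofPred_eq, reflectCoord, if_true, Set.mem_Icc]
          constructor <;> rintro ⟨h, h'⟩ <;> constructor <;> linarith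
        simp only [Set.mem_preimage, Set.mem_sdiff, h1, h2]
      have hemb : MeasurableEmbedding (reflectCoord (r := r) a k) :=
        (MeasurableEquiv.ofInvolutive _ (involutive_reflectCoord a k)
          (measurePreserving_reflectCoord a k).measurable).measurableEmbedding
      -- The reflection preserves the measure and `A \ B` and changes the sign of F there, so the
      -- integral equals its own negative.
      have hzero : ∫ u in A \ B, F u = 0 := by
        have h1 := (measurePreserving_reflectCoord a k).setIntegral_preimage_emb hemb F (A \ B)
        rw [hpre, setIntegral_congr_fun (hA.diff hB) (g := fun u => -F u)
          (fun u hu => hflip u k hu.2), integral_neg] at h1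
        exact self_eq_neg.mp h1.symm
      rw [hAB, ← integral_inter_add_sdiff hB hF.integrableOn, hzero, add_zero]
  rw [key Finset.univ]
  congr 2
  ext u
  simp only [Finset.mem_univ, true_implies, Set.mem_ofPred_eq, Set.mem_pi, Set.mem_univ]

lemma hankelPath_reflect {ε u : ℝ} (hu : u ∉ Set.Icc 0 (2 * Real.pi)) :
    hankelPath ε (2 * Real.pi - u) = hankelPath ε u := by
  have := Real.pi_pos
  rw [Set.mem_Icc, not_and_or, not_le, not_le] at hu
  rcases hu with h | h
  · rw [hankelPath, if_neg (by linarith), if_neg (by linarith), hankelPath, if_pos h]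
    congr 1
    ring
  · rw [hankelPath, if_pos (by linarith), hankelPath, if_neg (by linarith), if_neg (by linarith)]
    congr 1
    ring

lemma hankelVel_reflect {ε u : ℝ} (hu : u ∉ Set.Icc 0 (2 * Real.pi)) :
    hankelVel ε (2 * Real.pi - u) = -hankelVel ε u := by
  have := Real.pi_pos
  rw [Set.mem_Icc, not_and_or, not_le, not_le] at hu
  rcases hu with h | h
  · rw [hankelVel, if_neg (by linarith), if_neg (by linarith), hankelVel, if_pos h, neg_neg]
  · rw [hankelVel, if_pos (by linarith), hankelVel, if_neg (by linarith), if_neg (by linarith)]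

/-- An integer power forgets the branch of the logarithm. On the two rays it therefore agrees, and
only the velocity changes sign. -/
lemma exp_neg_nat_sub_one_mul_hankelLog {ε : ℝ} (hε : 0 < ε) (m : ℕ) (u : ℝ) :
    Complex.exp ((-(m : ℂ) - 1) * hankelLog ε u) = (hankelPath ε u ^ (m + 1))⁻¹ := by
  rw [← exp_hankelLog hε, ← Complex.exp_nat_mul, ← Complex.exp_neg]
  congr 1
  push_cast
  ring

lemma limIntegrand_reflect {r : ℕ} (γ : Fin r → ℂ) {ε : ℝ} (hε : 0 < ε) (m : Fin r → ℕ)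
    (u : Fin r → ℝ) (k : Fin r) (hu : u k ∉ Set.Icc 0 (2 * Real.pi)) :
    limIntegrand ε γ (fun j => -(m j : ℂ)) (reflectCoord (2 * Real.pi) k u) =
      -limIntegrand ε γ (fun j => -(m j : ℂ)) u := by
  have hp : ∀ i, hankelPath ε (reflectCoord (2 * Real.pi) k u i) = hankelPath ε (u i) := by
    intro i
    by_cases h : i = k
    · subst h
      simp [reflectCoord, hankelPath_reflect hu]
    · simp [reflectCoord, h]
  have hv : ∀ i, hankelVel ε (reflectCoord (2 * Real.pi) k u i) =
      (if i = k then -1 else 1) * hankelVel ε (u i) := by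
    intro i
    by_cases h : i = k
    · subst h
      simp [reflectCoord, hankelVel_reflect hu]
    · simp [reflectCoord, h]
  simp only [limIntegrand, exp_neg_nat_sub_one_mul_hankelLog hε, hp, hv]
  simp only [Finset.prod_mul_distrib, Finset.prod_ite_eq', Finset.mem_univ, if_true]
  ring

/-! ### Cauchy's formula on the torus. -/

lemma hankel_monomial_eq {ε : ℝ} (hε : 0 < ε) (n m : ℕ) {u : ℝ}
    (hu : u ∈ Set.Icc 0 (2 * Real.pi)) :
    hankelPath ε u ^ n * (Complex.exp ((-(m : ℂ) - 1) * hankelLog ε u) * hankelVel ε u) =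
      Complex.I * Complex.exp (((n : ℂ) - m) * Real.log ε) *
        Complex.exp (((n : ℂ) - m) * Complex.I * u) := by
  have hL : hankelLog ε u = (Real.log ε : ℂ) + Complex.I * u := by
    rw [hankelLog, if_neg (not_lt.mpr hu.1), if_pos hu.2]
  have hV : hankelVel ε u = Complex.I * hankelPath ε u := by
    rw [hankelVel, if_neg (not_lt.mpr hu.1), if_pos hu.2, hankelPath, if_neg (not_lt.mpr hu.1),
      if_pos hu.2]
  rw [hV, ← exp_hankelLog hε, ← Complex.exp_nat_mul, mul_assoc Complex.I, ← Complex.exp_add,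
    mul_left_comm _ Complex.I, mul_left_comm _ Complex.I, ← Complex.exp_add, ← Complex.exp_add, hL]
  congr 2
  ring

lemma integral_hankel_monomial {ε : ℝ} (hε : 0 < ε) (n m : ℕ) :
    ∫ u in Set.Icc 0 (2 * Real.pi), hankelPath ε u ^ n *
      (Complex.exp ((-(m : ℂ) - 1) * hankelLog ε u) * hankelVel ε u) =
      if n = m then 2 * Real.pi * Complex.I else 0 := by
  rw [setIntegral_congr_fun measurableSet_Icc (fun u hu => hankel_monomial_eq hε n m hu),
    integral_const_mul, integral_Icc_eq_integral_Ioc,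
    ← intervalIntegral.integral_of_le Real.two_pi_pos.le]
  split_ifs with h
  · subst h
    simp
    ring
  · have hc : ((n : ℂ) - m) * Complex.I ≠ 0 :=
      mul_ne_zero (sub_ne_zero.mpr (by exact_mod_cast h)) Complex.I_ne_zero
    rw [integral_exp_mul_complex hc]
    have h1 : Complex.exp (((n : ℂ) - m) * Complex.I * ((2 * Real.pi : ℝ) : ℂ)) = 1 := by
      rw [Complex.exp_eq_one_iff]
      exact ⟨(n : ℤ) - m, by push_cast; ring⟩
    rw [h1]
    simp

lemma norm_hankel_monomial {ε : ℝ} (hε : 0 < ε) (n m : ℕ) {u : ℝ}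
    (hu : u ∈ Set.Icc 0 (2 * Real.pi)) :
    ‖hankelPath ε u ^ n * (Complex.exp ((-(m : ℂ) - 1) * hankelLog ε u) * hankelVel ε u)‖ =
      ε ^ n * (ε ^ m)⁻¹ := by
  rw [hankel_monomial_eq hε n m hu, norm_mul, norm_mul, Complex.norm_I, one_mul,
    show ((n : ℂ) - m) * Complex.I * u = (((n - m : ℝ) * u : ℝ) : ℂ) * Complex.I by
      push_cast; ring, Complex.norm_exp_ofReal_mul_I, mul_one,
    show ((n : ℂ) - m) * (Real.log ε : ℂ) = ((n * Real.log ε - m * Real.log ε : ℝ) : ℂ) by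
      push_cast; ring, ← Complex.ofReal_exp, Complex.norm_real,
    Real.norm_of_nonneg (Real.exp_nonneg _), Real.exp_sub, Real.exp_nat_mul, Real.exp_nat_mul,
    Real.exp_log hε, div_eq_mul_inv]

lemma norm_hankelPath_of_mem {ε : ℝ} (hε : 0 < ε) {u : ℝ} (hu : u ∈ Set.Icc 0 (2 * Real.pi)) :
    ‖hankelPath ε u‖ = ε := by
  have h := norm_hankelPath_sub_le hε u
  rw [hankelPath, if_neg (not_lt.mpr hu.1), if_pos hu.2, norm_mul, mul_comm Complex.I,
    Complex.norm_exp_ofReal_mul_I, mul_one, Complex.norm_real, Real.norm_of_nonneg hε.le]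

/-- Cauchy's formula for the Taylor coefficients, over the torus of radius `ε`. -/
lemma setIntegral_limIntegrand_neg_nat {r : ℕ} (γ : Fin r → ℂ) {ε : ℝ} (hε : 0 < ε)
    (hconv : ∀ j, ‖γ j‖ * (r * ε) < 1) (m : Fin r → ℕ) :
    ∫ u in Set.univ.pi fun _ => Set.Icc 0 (2 * Real.pi),
      limIntegrand ε γ (fun j => -(m j : ℂ)) u = (2 * Real.pi * Complex.I) ^ r * taylorCoeff γ m := by
  set Q : Set (Fin r → ℝ) := Set.univ.pi fun _ => Set.Icc 0 (2 * Real.pi) with hQ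
  have hQm : MeasurableSet Q := MeasurableSet.univ_pi fun _ => measurableSet_Icc
  have hrestrict : (volume : Measure (Fin r → ℝ)).restrict Q =
      Measure.pi fun _ => (volume : Measure ℝ).restrict (Set.Icc 0 (2 * Real.pi)) := by
    rw [volume_pi, hQ, Measure.restrict_pi_pi]
  have hfin : IsFiniteMeasure ((volume : Measure (Fin r → ℝ)).restrict Q) := by
    rw [hrestrict]
    infer_instance
  let T : (Fin r → ℕ) → (Fin r → ℝ) → ℂ := fun n u => taylorCoeff γ n *
    ∏ l, (hankelPath ε (u l) ^ n l *
      (Complex.exp ((-(m l : ℂ) - 1) * hankelLog ε (u l)) * hankelVel ε (u l)))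
  have hint : ∀ n, ∫ u in Q, T n u =
      taylorCoeff γ n * ∏ l, if n l = m l then 2 * Real.pi * Complex.I else 0 := by
    intro n
    rw [integral_const_mul, hrestrict, integral_fintype_prod_eq_prod
      (f := fun l u => hankelPath ε u ^ n l *
        (Complex.exp ((-(m l : ℂ) - 1) * hankelLog ε u) * hankelVel ε u))]
    simp_rw [integral_hankel_monomial hε]
  -- Absolute convergence at the single point (ε, …, ε) dominates the Taylor series on the whole
  -- torus.
  have hε_sum : ∀ j, ‖γ j‖ * ∑ _l : Fin r, ‖(ε : ℂ)‖ < 1 := by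
    intro j
    rw [Finset.sum_const, Finset.card_univ, Fintype.card_fin, nsmul_eq_mul, Complex.norm_real,
      Real.norm_of_nonneg hε.le]
    exact hconv j
  have hsum := (hasSum_taylorCoeff γ (fun _ => (ε : ℂ)) hε_sum).1
  have hbound : ∀ n, ∀ u ∈ Q, ‖T n u‖ ≤
      ‖taylorCoeff γ n * ∏ l, (ε : ℂ) ^ n l‖ * ∏ l, (ε ^ m l)⁻¹ := by
    intro n u hu
    have h1 : ∏ l, ‖hankelPath ε (u l) ^ n l *
      (Complex.exp ((-(m l : ℂ) - 1) * hankelLog ε (u l)) * hankelVel ε (u l))‖ =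
        ∏ l, (ε ^ n l * (ε ^ m l)⁻¹) :=
      Finset.prod_congr rfl fun l _ => norm_hankel_monomial hε _ _ (hu l (Set.mem_univ l))
    rw [norm_mul, norm_prod, h1, Finset.prod_mul_distrib, norm_mul, norm_prod, mul_assoc]
    simp_rw [norm_pow, Complex.norm_real, Real.norm_of_nonneg hε.le]
    exact le_rfl
  have hlim : ∀ u ∈ Q, HasSum (fun n => T n u) (limIntegrand ε γ (fun j => -(m j : ℂ)) u) := by
    intro u hu
    have h1 := (hasSum_taylorCoeff γ (fun l => hankelPath ε (u l)) fun j => by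
      rw [Finset.sum_congr rfl fun l _ => norm_hankelPath_of_mem hε (hu l (Set.mem_univ l)),
        Finset.sum_const, Finset.card_univ, Fintype.card_fin, nsmul_eq_mul]
      exact hconv j).2
    refine (h1.mul_right (∏ k, (Complex.exp ((-(m k : ℂ) - 1) * hankelLog ε (u k)) *
      hankelVel ε (u k)))).congr_fun fun n => ?_
    simp only [T]
    rw [Finset.prod_mul_distrib, mul_assoc]
  have hS := hasSum_integral_of_dominated_convergence (μ := volume.restrict Q) (F := T)
    (f := limIntegrand ε γ (fun j => -(m j : ℂ)))
    (fun n _ => ‖taylorCoeff γ n * ∏ l, (ε : ℂ) ^ n l‖ * ∏ l, (ε ^ m l)⁻¹)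
    (fun n => by
      have h1 := measurable_hankelLog ε
      have h2 := measurable_hankelVel ε
      have h3 := measurable_hankelPath ε
      exact Measurable.aestronglyMeasurable (by fun_prop))
    (fun n => (ae_restrict_iff' hQm).mpr (ae_of_all _ (hbound n)))
    (ae_of_all _ fun _ => hsum.mul_right _) (integrable_const _)
    ((ae_restrict_iff' hQm).mpr (ae_of_all _ hlim))
  simp_rw [hint] at hS
  -- By orthogonality only the term n = m survives.
  have hS' := hasSum_single (f := fun n : Fin r → ℕ =>
    taylorCoeff γ n * ∏ l, if n l = m l then 2 * Real.pi * Complex.I else 0) m fun n hn => by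
      obtain ⟨l, hl⟩ := Function.ne_iff.mp hn
      rw [Finset.prod_eq_zero (Finset.mem_univ l) (if_neg hl), mul_zero]
  rw [hS.unique hS']
  simp [mul_comm]

lemma integral_limIntegrand_neg_nat {r : ℕ} {γ : Fin r → ℂ} (hγ : ∀ j, 0 < (γ j).re) {ε : ℝ}
    (hε : 0 < ε) (hρ : ∀ j, 2 * (r * ε) * Complex.normSq (γ j) < 2 * Real.pi * (γ j).re)
    (hconv : ∀ j, ‖γ j‖ * (r * ε) < 1) (m : Fin r → ℕ) :
    ∫ u, limIntegrand ε γ (fun j => -(m j : ℂ)) u =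
      (2 * Real.pi * Complex.I) ^ r * taylorCoeff γ m := by
  obtain ⟨K, hK, hs⟩ := exists_norm_sub_one_le fun j => -(m j : ℂ)
  obtain ⟨B, hB, H⟩ := exists_integrable_majorant hγ hε hρ hK
  have hint : Integrable (limIntegrand ε γ fun j => -(m j : ℂ)) :=
    Integrable.mono' hB (measurable_limIntegrand ε γ _).aestronglyMeasurable
      (ae_of_all _ fun u => (H _ hs u).1)
  rw [integral_eq_setIntegral_of_reflect hint (2 * Real.pi)
    (fun u k hu => limIntegrand_reflect γ hε m u k hu),
    setIntegral_limIntegrand_neg_nat γ hε hconv]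

/-! ### The values at (-m_j) and the conclusion. -/

lemma tendsto_generic {r : ℕ} {γ : Fin r → ℂ} (hγ : ∀ j, 0 < (γ j).re) {ε : ℝ}
    (hε : 0 < ε) (hρ : ∀ j, 2 * (r * ε) * Complex.normSq (γ j) < 2 * Real.pi * (γ j).re)
    (hconv : ∀ j, ‖γ j‖ * (r * ε) < 1) (m : Fin r → ℕ) :
    Tendsto (generic ε γ) (𝓝[nonIntegral r] fun j => -(m j : ℂ))
      (𝓝 ((∏ l, ((-1) ^ m l * ((m l).factorial : ℂ))) * taylorCoeff γ m)) := by
  have h := (tendsto_hankelFactor m).mul (((continuous_integral_limIntegrand hγ hε hρ).tendsto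
    fun j => -(m j : ℂ)).mono_left (nhdsWithin_le_nhds (s := nonIntegral r)))
  have hval : (∏ k, ((-1) ^ m k * ((m k).factorial : ℂ) / (2 * Real.pi * Complex.I))) *
      ((2 * Real.pi * Complex.I) ^ r * taylorCoeff γ m) =
      (∏ l, ((-1) ^ m l * ((m l).factorial : ℂ))) * taylorCoeff γ m := by
    have h2 : (2 * Real.pi * Complex.I : ℂ) ^ r ≠ 0 := pow_ne_zero _ Complex.two_pi_I_ne_zero
    rw [Finset.prod_div_distrib, Finset.prod_const, Finset.card_univ, Fintype.card_fin,
      ← mul_assoc, div_mul_cancel₀ _ h2]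
  rw [integral_limIntegrand_neg_nat hγ hε hρ hconv, hval] at h
  exact h.congr fun s => (generic_eq hγ hε hρ s).symm

lemma eventually_mul_lt {a b : ℝ} (hb : 0 < b) : ∀ᶠ ε : ℝ in 𝓝[>] 0, a * ε < b := by
  have h : Tendsto (fun ε : ℝ => a * ε) (𝓝[>] 0) (𝓝 0) := by
    have hc : Continuous fun ε : ℝ => a * ε := by fun_prop
    have := hc.tendsto 0
    rw [mul_zero] at this
    exact this.mono_left nhdsWithin_le_nhds
  exact h.eventually_lt_const hb

/-- The first family of inequalities keeps the poles off the contour, the second makes the Taylor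
series converge on the torus. -/
lemma eventually_small_radius {r : ℕ} {γ : Fin r → ℂ} (hγ : ∀ j, 0 < (γ j).re) :
    ∀ᶠ ε : ℝ in 𝓝[>] 0, 0 < ε ∧
      (∀ j, 2 * (r * ε) * Complex.normSq (γ j) < 2 * Real.pi * (γ j).re) ∧
      ∀ j, ‖γ j‖ * (r * ε) < 1 := by
  have h1 : ∀ j, ∀ᶠ ε : ℝ in 𝓝[>] 0,
      2 * (r * ε) * Complex.normSq (γ j) < 2 * Real.pi * (γ j).re := fun j => by
    filter_upwards [eventually_mul_lt (a := 2 * r * Complex.normSq (γ j))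
      (mul_pos Real.two_pi_pos (hγ j))] with ε h
    linarith
  have h2 : ∀ j, ∀ᶠ ε : ℝ in 𝓝[>] 0, ‖γ j‖ * (r * ε) < 1 := fun j => by
    filter_upwards [eventually_mul_lt (a := ‖γ j‖ * r) one_pos] with ε h
    linarith
  filter_upwards [self_mem_nhdsWithin, eventually_all.mpr h1, eventually_all.mpr h2] with ε a b c
  exact ⟨a, b, c⟩

/-- The limit in s is the same for all small ε, so the outer limit is that of an eventually constant
function. -/
lemma desZeta_neg_nat {r : ℕ} {γ : Fin r → ℂ} (hγ : ∀ j, 0 < (γ j).re) (m : Fin r → ℕ) :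
    desZeta γ (fun j => -(m j : ℂ)) =
      (∏ l, ((-1) ^ m l * ((m l).factorial : ℂ))) * taylorCoeff γ m := by
  refine Tendsto.limUnder_eq (tendsto_const_nhds.congr' ?_)
  have := neBot_nhdsWithin_nonIntegral m
  filter_upwards [eventually_small_radius hγ] with ε h
  exact (tendsto_generic hγ h.1 h.2.1 h.2.2 m).limUnder_eq.symm

lemma eventually_norm_mul_sum_lt {r : ℕ} (γ : Fin r → ℂ) :
    ∀ᶠ t : Fin r → ℂ in 𝓝 0, ∀ j, ‖γ j‖ * ∑ l, ‖t l‖ < 1 := by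
  refine eventually_all.mpr fun j => ?_
  have hc : Continuous fun t : Fin r → ℂ => ‖γ j‖ * ∑ l, ‖t l‖ := by fun_prop
  have h := hc.tendsto 0
  simp only [Pi.zero_apply, norm_zero, Finset.sum_const_zero, mul_zero] at h
  exact h.eventually_lt_const one_pos

end DesZeta

theorem mainTheorem4 (r : ℕ) (γ : Fin r → ℂ) (hγ : ∀ j, 0 < (γ j).re) :
    -- for all small radii of the contour, the integrals and limits defining `ζ^des` exist
    (∀ᶠ ε in 𝓝[>] (0 : ℝ),
      (∀ s ∈ DesZeta.nonIntegral r,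
        (∀ᶠ c in 𝓝[≠] (1 : ℝ), Integrable (DesZeta.integrand ε γ c s)) ∧
        Tendsto (fun c => DesZeta.approx ε γ c s) (𝓝[≠] (1 : ℝ)) (𝓝 (DesZeta.generic ε γ s))) ∧
      ∀ m : Fin r → ℕ,
        Tendsto (DesZeta.generic ε γ) (𝓝[DesZeta.nonIntegral r] (fun j => -(m j : ℂ)))
          (𝓝 (DesZeta.desZeta γ (fun j => -(m j : ℂ))))) ∧
    -- the generating function
    (∀ᶠ t in 𝓝 (0 : Fin r → ℂ),
      HasSum
        (fun m : Fin r → ℕ => (-1) ^ (∑ j, m j) * DesZeta.desZeta γ (fun j => -(m j : ℂ)) *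
          ∏ j, (t j ^ m j / ((m j).factorial : ℂ)))
        (∏ j, DesZeta.genFactor (γ j * DesZeta.tailSum t j))) ∧
    -- the explicit values
    (∀ k : Fin r → ℕ,
      DesZeta.desZeta γ (fun j => -(k j : ℂ)) =
        (∏ l, ((-1) ^ k l * ((k l).factorial : ℂ))) *
          ∑ ν ∈ DesZeta.indexFamilies k,
            ∏ j, (((bernoulli (1 + ∑ l ∈ Finset.Ici j, ν l j) : ℚ) : ℂ) *
              γ j ^ (∑ l ∈ Finset.Ici j, ν l j) *
              (1 / ∏ d ∈ Finset.Iic j, ((ν j d).factorial : ℂ)))) := by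
  refine ⟨?_, ?_, DesZeta.desZeta_neg_nat hγ⟩
  · filter_upwards [DesZeta.eventually_small_radius hγ] with ε h
    refine ⟨fun s _ => ⟨DesZeta.eventually_integrable_integrand hγ h.1 h.2.1 s, ?_⟩, fun m => ?_⟩
    · rw [DesZeta.generic_eq hγ h.1 h.2.1 s]
      exact DesZeta.tendsto_approx hγ h.1 h.2.1 s
    · rw [DesZeta.desZeta_neg_nat hγ m]
      exact DesZeta.tendsto_generic hγ h.1 h.2.1 h.2.2 m
  · filter_upwards [DesZeta.eventually_norm_mul_sum_lt γ] with t ht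
    refine (DesZeta.hasSum_taylorCoeff γ t ht).2.congr_fun fun m => ?_
    -- The signs and factorials in the special value cancel those of the generating series, leaving
    -- the Taylor series itself.
    have h1 : ((-1 : ℂ) ^ ∑ j, m j) * ∏ l, (-1) ^ m l = 1 := by
      rw [Finset.prod_pow_eq_pow_sum, ← mul_pow, neg_one_mul, neg_neg, one_pow]
    have h2 : ∏ l, ((m l).factorial : ℂ) ≠ 0 :=
      Finset.prod_ne_zero_iff.mpr fun l _ => by exact_mod_cast (m l).factorial_ne_zero
    rw [DesZeta.desZeta_neg_nat hγ m, Finset.prod_mul_distrib, Finset.prod_div_distrib]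
    rw [mul_div_assoc', div_eq_iff h2]
    linear_combination (DesZeta.taylorCoeff γ m * (∏ l, t l ^ m l) *
      ∏ l, ((m l).factorial : ℂ)) * h1
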